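/- Let $\mathcal M$ be a model of (first-order) Peano Arithmetic, viewed as an ordered commutative ring whose non-negative part satisfies PA. Let $p\in\mathcal M$ be a prime, $p>0$, and let $k\in\mathcal M$, $k>0$ ($p$ and $k$ may be standard or nonstandard). Let $p^k\in\mathcal M$ be the (existing) value of the exponential function of $\mathcal M$, as defined arithmetically through G\"odel's coding of sequences. Then $\mathcal M/p^k\mathcal M$ is a local ring, and there is a commutative ring $R$ such that: 1. $R$ is a Henselian valuation domain of characteristic $0$ which is unramified (that is, if the residue field of $R$ has prime characteristic $\ell$, then $v(\ell)$ is the least positive element of the value group). The value group $\Gamma$ of $R$ is a $\mathbb Z$-group (a model of Presburger arithmetic, i.e. an ordered abelian group with a least positive element $1_\Gamma$ such that for all integers $n\ge 1$ every $x\in\Gamma$ is of the form $ny+r1_\Gamma$ with $y\in\Gamma$, $0\le r<n$). Further, $\Gamma$ has $[0,k]$ as an initial segment of its non-negative part: there are $\gamma\in\Gamma$, $\gamma>0$, and an order isomorphism $[0,k]_{\mathcal M}\cong[0,\gamma]_\Gamma$ that respects those sums which stay in the segment. 2. $\mathcal M/p^k\mathcal M$ is isomorphic to $R/I$ for a principal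 ideal $I$ of $R$, namely $I=\alpha R$ for some $\alpha\ne 0$ with $v(\alpha)=\gamma$. 3. The residue field of $R$ is naturally isomorphic to the residue field of $\mathcal M/p^k\mathcal M$, that is, by an isomorphism compatible with $R\to R/I\cong\mathcal M/p^k\mathcal M$. -/

import Mathlib

open FirstOrder Language

universe u

/-! ### Peano Arithmetic -/

/-- The function symbols `0, 1, +, ·` of the language of arithmetic. -/
inductive ArithFunc : ℕ → Type
  | zero : ArithFunc 0
  | one : ArithFunc 0
  | add : ArithFunc 2
  | mul : ArithFunc 2

/-- The first-order language of arithmetic. (The order is definable: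
`x ≤ y` if and only if `x + z = y` for some `z`.) -/
def arith : Language where
  Functions := ArithFunc
  Relations := fun _ => Empty

namespace arith

/-- The constant term `0`. -/
def tZero {α : Type} : arith.Term α := Constants.term (L := arith) ArithFunc.zero

/-- The constant term `1`. -/
def tOne {α : Type} : arith.Term α := Constants.term (L := arith) ArithFunc.one

/-- The term `s + t`. -/
def tAdd {α : Type} (s t : arith.Term α) : arith.Term α :=
  Functions.apply₂ (L := arith) ArithFunc.add s t

/-- The term `s · t`. -/
def tMul {α : Type} (s t : arith.Term α) : arith.Term α :=
  Functions.apply₂ (L := arith) ArithFunc.mul s t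

/-- The tautological interpretation of the symbols `0, 1, +, ·`. -/
instance instStructure {M : Type*} [Zero M] [One M] [Add M] [Mul M] : arith.Structure M where
  funMap := fun {_} f =>
    match f with
    | ArithFunc.zero => fun _ => 0
    | ArithFunc.one => fun _ => 1
    | ArithFunc.add => fun v => v 0 + v 1
    | ArithFunc.mul => fun v => v 0 * v 1
  RelMap := fun {_} r => nomatch r

/-- `∀ x, x + 1 ≠ 0` -/
def axSuccNeZero : arith.Sentence :=
  ∀' ∼(tAdd (&0) tOne =' tZero)

/-- `∀ x y, x + 1 = y + 1 → x = y` -/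
def axSuccInj : arith.Sentence :=
  ∀' ∀' ((tAdd (&0) tOne =' tAdd (&1) tOne) ⟹ (&0 =' &1))

/-- `∀ x, x + 0 = x` -/
def axAddZero : arith.Sentence :=
  ∀' (tAdd (&0) tZero =' &0)

/-- `∀ x y, x + (y + 1) = (x + y) + 1` -/
def axAddSucc : arith.Sentence :=
  ∀' ∀' (tAdd (&0) (tAdd (&1) tOne) =' tAdd (tAdd (&0) (&1)) tOne)

/-- `∀ x, x · 0 = 0` -/
def axMulZero : arith.Sentence :=
  ∀' (tMul (&0) tZero =' tZero)

/-- `∀ x y, x · (y + 1) = x · y + x` -/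
def axMulSucc : arith.Sentence :=
  ∀' ∀' (tMul (&0) (tAdd (&1) tOne) =' tAdd (tMul (&0) (&1)) (&0))

/-- The instance of the induction scheme for the formula `φ(a₁, …, aₙ, x)`, where the induction
variable `x` is the one indexed by `Fin 1`:
`∀ a₁ … aₙ, φ(a, 0) → (∀ x, φ(a, x) → φ(a, x + 1)) → ∀ x, φ(a, x)`. -/
noncomputable def induction (n : ℕ) (φ : arith.Formula (Fin n ⊕ Fin 1)) : arith.Sentence :=
  let base : arith.Formula (Fin n) :=
    φ.subst (Sum.elim (fun i => Term.var i) (fun _ => tZero))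
  let step : arith.Formula (Fin n) :=
    Formula.iAlls (Fin 1) (φ.imp
      (φ.subst (Sum.elim (fun i => Term.var (Sum.inl i))
        (fun j => tAdd (Term.var (Sum.inr j)) tOne))))
  let concl : arith.Formula (Fin n) := Formula.iAlls (Fin 1) φ
  Formula.iAlls (Fin n) ((base.imp (step.imp concl)).relabel Sum.inr)

/-- First-order Peano Arithmetic `PA`. -/
def peano : arith.Theory :=
  {axSuccNeZero, axSuccInj, axAddZero, axAddSucc, axMulZero, axMulSucc} ∪
    {σ | ∃ (n : ℕ) (φ : arith.Formula (Fin n ⊕ Fin 1)), σ = induction n φ}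

end arith

/-- An ordered commutative ring `M` is (the ring of integers of) a model of Peano Arithmetic if its
non-negative part, with the operations of `M`, is a model of `PA`. -/
def IsPeanoRing (M : Type u) [CommRing M] [LinearOrder M] [IsStrictOrderedRing M] : Prop :=
  {x : M // 0 ≤ x} ⊨ arith.peano

/-! ### Exponentiation in a model of Peano Arithmetic -/

/-- `r` is the remainder of `a` on division by `m`. -/
def IsRem {M : Type u} [CommRing M] [LinearOrder M] (a m r : M) : Prop :=
  0 ≤ r ∧ r < m ∧ m ∣ a - r

/-- The graph of Gödel's beta function: `r = β(a, b, i)`, the remainder of `a` on division by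
`1 + (i + 1) b`. -/
def IsBeta {M : Type u} [CommRing M] [LinearOrder M] (a b i r : M) : Prop :=
  IsRem a (1 + (i + 1) * b) r

/-- The graph of the exponential function of a model of Peano Arithmetic, given by its usual
arithmetical definition: `q = p ^ k` if there is a (code of a) sequence `s₀, …, s_k` with `s₀ = 1`,
`s_{i + 1} = p s_i` for `i < k`, and `s_k = q`. Here `k` may be nonstandard. -/
def IsPow {M : Type u} [CommRing M] [LinearOrder M] (p k q : M) : Prop :=
  ∃ a b : M, 0 ≤ a ∧ 0 ≤ b ∧ IsBeta a b 0 1 ∧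
    (∀ i : M, 0 ≤ i → i < k → ∃ r : M, IsBeta a b i r ∧ IsBeta a b (i + 1) (p * r)) ∧
    IsBeta a b k q

/-! ### Valuation domains and ℤ-groups -/

/-- A `ℤ`-group (model of Presburger arithmetic): an ordered abelian group with a least positive
element `e` such that for all `n ≥ 1` every element is of the form `n y + r e` with `0 ≤ r < n`. -/
def IsPresburgerGroup (Γ : Type u) [AddCommGroup Γ] [LinearOrder Γ] [IsOrderedAddMonoid Γ] : Prop :=
  ∃ e : Γ, IsLeast {x : Γ | 0 < x} e ∧
    ∀ n : ℕ, 0 < n → ∀ x : Γ, ∃ (y : Γ) (r : ℕ), r < n ∧ x = n • y + r • e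

/-- The value group `K^×/R^×` of a valuation domain `R` with fraction field `K`, written additively
and ordered so that the elements of `R` have value `≥ 0`. (Mathlib's `ValuationRing.ValueGroup` is
multiplicative, contains the value of `0`, and has the values of elements of `R` at most `1`, whence
the units, `Additive` and the order dual.) -/
abbrev AddValueGroup (R : Type u) [CommRing R] [IsDomain R] [ValuationRing R] : Type u :=
  (Additive (ValuationRing.ValueGroup R (FractionRing R))ˣ)ᵒᵈ

/-- The additive value `v(x)` of a nonzero element `x` of a valuation domain. -/
noncomputable def addVal {R : Type u} [CommRing R] [IsDomain R] [ValuationRing R]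
    (x : R) (hx : x ≠ 0) : AddValueGroup R :=
  OrderDual.toDual (Additive.ofMul (Units.mk0
    (ValuationRing.valuation R (FractionRing R) (algebraMap R (FractionRing R) x))
    ((Valuation.ne_zero_iff _).2
      ((map_ne_zero_iff _ (IsFractionRing.injective R (FractionRing R))).2 hx))))

/-- A valuation domain of characteristic zero is unramified if either its residue field has
characteristic zero, or its residue field has characteristic a prime `ℓ` and `v(ℓ)` is the least
positive element of the value group. -/
def IsUnramifiedValuation (R : Type u) [CommRing R] [IsDomain R] [ValuationRing R] : Prop :=
  ∀ ℓ : ℕ, ℓ.Prime → (ℓ : R) ∈ IsLocalRing.maximalIdeal R →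
    ∃ h : (ℓ : R) ≠ 0, IsLeast {γ : AddValueGroup R | 0 < γ} (addVal (ℓ : R) h)

/-- The segments `[0, k]` and `[0, γ]` of two ordered abelian groups are isomorphic as ordered
partial (equivalently, truncated) additive structures. -/
def SegmentIso {M : Type u} [AddCommGroup M] [LinearOrder M] {Γ : Type u} [AddCommGroup Γ]
    [LinearOrder Γ] (k : M) (γ : Γ) : Prop :=
  ∃ f : Set.Icc (0 : M) k ≃o Set.Icc (0 : Γ) γ,
    ∀ x y z : Set.Icc (0 : M) k, (x : M) + y = z → (f x : Γ) + f y = f z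

/-!
The ring `R` is the inverse limit of the rings `M ⧸ (p ^ n)` over all `n ≥ 0` in `M`, nonstandard
`n` included. Gödel's beta function and induction in `M` provide the powers `p ^ n`, the
factorization of every nonzero element of `M` as `p ^ n * u` with `u` prime to `p`, and, by Newton
iteration, Hensel's lemma modulo each `p ^ n`. Since Hensel lifts are unique, they are compatible
and glue to roots in the limit, which is therefore Henselian. Every nonzero element of the limit is
a unit times some `p ^ n`, so the value group of `R` is `M` itself, with `p ^ n` of value `n`; in
particular it is a `ℤ`-group and `R` is unramified. Finally, the kernel of `R → M ⧸ (p ^ k)` is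
generated by `p ^ k`.
-/

/-! ### Arithmetical predicates -/

section Definability

/-- The non-negative part of an ordered ring, the universe of the model of Peano Arithmetic. -/
abbrev NonnegPart (M : Type u) [CommRing M] [LinearOrder M] : Type u :=
  {x : M // 0 ≤ x}

variable {M : Type u} [CommRing M] [LinearOrder M] [IsStrictOrderedRing M] {α β : Type}

/-- A predicate on tuples of elements of `M` is arithmetical if it is defined by a formula with
parameters in the non-negative part of `M`, each variable of `M` being encoded as a difference of
two non-negative variables. -/
@[fun_prop]
def IsArithmetical (P : (α → M) → Prop) : Prop :=
  (Set.univ : Set (NonnegPart M)).Definable arith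
    {v : α × Bool → NonnegPart M | P fun a => v (a, true) - v (a, false)}

/-- A function on tuples of elements of `M` is arithmetical if its graph is. -/
@[fun_prop]
def IsArithmeticalFun (F : (α → M) → M) : Prop :=
  IsArithmetical fun w : Option α → M => w none = F fun a => w (some a)

namespace arith

open Set

variable {γ : Type} {f g : (γ → NonnegPart M) → NonnegPart M}

@[fun_prop]
theorem definableFun_add (hf : univ.DefinableFun arith f) (hg : univ.DefinableFun arith g) :
    univ.DefinableFun arith fun v => f v + g v :=
  DefinableFun.comp (f := fun v => v 0 + v 1) (g := fun v => ![f v, g v])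
    (Fin.forall_fin_two.2 ⟨hf, hg⟩) (.of_empty (.fun_symbol (L := arith) ArithFunc.add))

@[fun_prop]
theorem definableFun_mul (hf : univ.DefinableFun arith f) (hg : univ.DefinableFun arith g) :
    univ.DefinableFun arith fun v => f v * g v :=
  DefinableFun.comp (f := fun v => v 0 * v 1) (g := fun v => ![f v, g v])
    (Fin.forall_fin_two.2 ⟨hf, hg⟩) (.of_empty (.fun_symbol (L := arith) ArithFunc.mul))

end arith

namespace IsArithmetical

@[fun_prop]
theorem not {P : (α → M) → Prop} (hP : IsArithmetical P) : IsArithmetical fun v => ¬ P v :=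
  hP.compl

@[fun_prop]
theorem and {P Q : (α → M) → Prop} (hP : IsArithmetical P) (hQ : IsArithmetical Q) :
    IsArithmetical fun v => P v ∧ Q v :=
  hP.inter hQ

@[fun_prop]
theorem imp {P Q : (α → M) → Prop} (hP : IsArithmetical P) (hQ : IsArithmetical Q) :
    IsArithmetical fun v => P v → Q v :=
  hP.himp hQ

theorem forall_finite [Finite β] {P : β → (α → M) → Prop} (hP : ∀ b, IsArithmetical (P b)) :
    IsArithmetical fun v => ∀ b, P b v := by
  unfold IsArithmetical
  rw [Set.ofPred_forall]
  exact Set.definable_iInter_of_finite hP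

theorem reindex {P : (α → M) → Prop} (hP : IsArithmetical P) (σ : α → β) :
    IsArithmetical fun v : β → M => P fun a => v (σ a) :=
  hP.preimage_comp (Prod.map σ id)

theorem exists_tuple [Finite β] {P : (α → M) → (β → M) → Prop}
    (hP : IsArithmetical fun w : α ⊕ β → M => P (fun a => w (.inl a)) fun b => w (.inr b)) :
    IsArithmetical fun v => ∃ x, P v x := by
  unfold IsArithmetical
  convert (hP.preimage_comp (Equiv.sumProdDistrib α β Bool)).exists_of_finite with v
  refine ⟨fun ⟨x, hx⟩ => ⟨fun b => if b.2 then ⟨_, posPart_nonneg (x b.1)⟩ else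
    ⟨_, negPart_nonneg (x b.1)⟩, ?_⟩, fun ⟨u, hu⟩ => ⟨_, hu⟩⟩
  simpa using hx

@[fun_prop]
theorem ex {P : (α → M) → M → Prop}
    (hP : IsArithmetical fun w : Option α → M => P (fun a => w (some a)) (w none)) :
    IsArithmetical fun v => ∃ x, P v x := by
  have h := (hP.reindex fun a => a.elim (Sum.inr ()) Sum.inl).exists_tuple
    (P := fun v x => P v (x ()))
  convert h with v
  exact ⟨fun ⟨x, hx⟩ => ⟨fun _ => x, hx⟩, fun ⟨x, hx⟩ => ⟨_, hx⟩⟩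

@[fun_prop]
theorem all {P : (α → M) → M → Prop}
    (hP : IsArithmetical fun w : Option α → M => P (fun a => w (some a)) (w none)) :
    IsArithmetical fun v => ∀ x, P v x := by
  simpa only [not_exists_not] using (ex (P := fun v x => ¬ P v x) hP.not).not

theorem comp [Finite β] {P : (β → M) → Prop} (hP : IsArithmetical P) {F : (α → M) → β → M}
    (hF : ∀ b, IsArithmeticalFun fun v => F v b) : IsArithmetical fun v => P (F v) := by
  have h := exists_tuple (P := fun v x => (∀ b, x b = F v b) ∧ P x)
    ((forall_finite fun b => (hF b).reindex fun a => a.elim (Sum.inr b) Sum.inl).and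
      (hP.reindex Sum.inr))
  simpa only [← funext_iff, exists_eq_left] using h

theorem of_definableFun {P : (α → M) → Prop} {f g : (α × Bool → NonnegPart M) → NonnegPart M}
    (hf : Set.univ.DefinableFun arith f) (hg : Set.univ.DefinableFun arith g)
    (h : ∀ v, (P fun a => v (a, true) - v (a, false)) ↔ f v = g v) : IsArithmetical P := by
  unfold IsArithmetical
  simpa only [h] using hf.ofPred_eq hg

end IsArithmetical

namespace IsArithmeticalFun

variable {F G : (α → M) → M}

@[fun_prop]
theorem var (a : α) : IsArithmeticalFun fun v : α → M => v a := by
  refine .of_definableFun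
    (f := fun v => v (none, true) + v (some a, false))
    (g := fun v => v (none, false) + v (some a, true)) (by fun_prop) (by fun_prop) fun v => ?_
  rw [← Subtype.coe_inj, Nonneg.coe_add, Nonneg.coe_add]
  grind

@[fun_prop]
theorem const (c : M) : IsArithmeticalFun fun _ : α → M => c := by
  refine .of_definableFun
    (f := fun v => v (none, true) + ⟨_, negPart_nonneg c⟩)
    (g := fun v => v (none, false) + ⟨_, posPart_nonneg c⟩)
    (by fun_prop (disch := simp)) (by fun_prop (disch := simp)) fun v => ?_
  rw [← Subtype.coe_inj, Nonneg.coe_add, Nonneg.coe_add]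
  grind [posPart_sub_negPart c]

theorem comp [Finite β] {F : (β → M) → M} (hF : IsArithmeticalFun F) {G : (α → M) → β → M}
    (hG : ∀ b, IsArithmeticalFun fun v => G v b) : IsArithmeticalFun fun v => F (G v) :=
  IsArithmetical.comp hF (F := fun w b => b.elim (w none) fun b => G (fun a => w (some a)) b)
    (Option.forall.2 ⟨var _, fun b => (hG b).reindex (Option.map some)⟩)

@[fun_prop]
theorem add (hF : IsArithmeticalFun F) (hG : IsArithmeticalFun G) :
    IsArithmeticalFun fun v => F v + G v := by
  have h : IsArithmeticalFun fun v : Fin 2 → M => v 0 + v 1 := by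
    refine .of_definableFun
      (f := fun v => v (none, true) + v (some 0, false) + v (some 1, false))
      (g := fun v => v (none, false) + v (some 0, true) + v (some 1, true))
      (by fun_prop) (by fun_prop) fun v => ?_
    simp only [← Subtype.coe_inj, Nonneg.coe_add]
    grind
  exact h.comp (G := fun v => ![F v, G v]) (Fin.forall_fin_two.2 ⟨hF, hG⟩)

@[fun_prop]
theorem mul (hF : IsArithmeticalFun F) (hG : IsArithmeticalFun G) :
    IsArithmeticalFun fun v => F v * G v := by
  have h : IsArithmeticalFun fun v : Fin 2 → M => v 0 * v 1 := by
    refine .of_definableFun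
      (f := fun v => v (none, true) + v (some 0, true) * v (some 1, false) +
        v (some 0, false) * v (some 1, true))
      (g := fun v => v (none, false) + v (some 0, true) * v (some 1, true) +
        v (some 0, false) * v (some 1, false)) (by fun_prop) (by fun_prop) fun v => ?_
    simp only [← Subtype.coe_inj, Nonneg.coe_add, Nonneg.coe_mul]
    grind
  exact h.comp (G := fun v => ![F v, G v]) (Fin.forall_fin_two.2 ⟨hF, hG⟩)

@[fun_prop]
theorem sub (hF : IsArithmeticalFun F) (hG : IsArithmeticalFun G) :
    IsArithmeticalFun fun v => F v - G v := by
  simpa only [sub_eq_add_neg, neg_one_mul] using hF.add ((const (-1)).mul hG)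

end IsArithmeticalFun

namespace IsArithmetical

variable {F G : (α → M) → M}

theorem comp₂ {R : M → M → Prop} (hR : IsArithmetical fun w : Fin 2 → M => R (w 0) (w 1))
    (hF : IsArithmeticalFun F) (hG : IsArithmeticalFun G) :
    IsArithmetical fun v => R (F v) (G v) :=
  hR.comp (F := fun v => ![F v, G v]) (Fin.forall_fin_two.2 ⟨hF, hG⟩)

@[fun_prop]
theorem eq (hF : IsArithmeticalFun F) (hG : IsArithmeticalFun G) :
    IsArithmetical fun v => F v = G v := by
  refine comp₂ (.of_definableFun (f := fun v => v (0, true) + v (1, false))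
    (g := fun v => v (0, false) + v (1, true)) (by fun_prop) (by fun_prop) fun v => ?_) hF hG
  rw [← Subtype.coe_inj, Nonneg.coe_add, Nonneg.coe_add]
  grind

@[fun_prop]
theorem dvd (hF : IsArithmeticalFun F) (hG : IsArithmeticalFun G) :
    IsArithmetical fun v => F v ∣ G v :=
  comp₂ (R := fun x y => ∃ z, y = x * z) (by fun_prop) hF hG

@[fun_prop]
theorem isCoprime (hF : IsArithmeticalFun F) (hG : IsArithmeticalFun G) :
    IsArithmetical fun v => IsCoprime (F v) (G v) :=
  comp₂ (R := IsCoprime) (by unfold IsCoprime; fun_prop) hF hG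

theorem nonneg : IsArithmetical fun v : Unit → M => 0 ≤ v () := by
  have h : (Set.univ : Set (NonnegPart M)).Definable arith
      {v : (Unit × Bool) ⊕ Unit → NonnegPart M |
        v (.inl ((), true)) = v (.inl ((), false)) + v (.inr ())} :=
    Set.DefinableFun.ofPred_eq (by fun_prop) (by fun_prop)
  unfold IsArithmetical
  convert h.exists_of_finite with v
  simp only [← Subtype.coe_inj, Nonneg.coe_add, Set.mem_ofPred_eq, Sum.elim_inl, Sum.elim_inr]
  exact ⟨fun h => ⟨fun _ => ⟨_, h⟩, by simp⟩, fun ⟨u, hu⟩ => by simp [hu, (u ()).2]⟩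

@[fun_prop]
theorem le (hF : IsArithmeticalFun F) (hG : IsArithmeticalFun G) :
    IsArithmetical fun v => F v ≤ G v := by
  simpa only [sub_nonneg] using nonneg.comp (F := fun v _ => G v - F v) fun _ => hG.sub hF

@[fun_prop]
theorem lt (hF : IsArithmeticalFun F) (hG : IsArithmeticalFun G) :
    IsArithmetical fun v => F v < G v := by
  simpa only [not_le] using (le hG hF).not

@[fun_prop]
theorem isBeta {A B I R : (α → M) → M} (hA : IsArithmeticalFun A) (hB : IsArithmeticalFun B)
    (hI : IsArithmeticalFun I) (hR : IsArithmeticalFun R) :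
    IsArithmetical fun v => IsBeta (A v) (B v) (I v) (R v) := by
  unfold IsBeta IsRem
  fun_prop

end IsArithmetical

@[fun_prop]
theorem IsArithmeticalFun.eval (f : Polynomial M) {F : (α → M) → M} (hF : IsArithmeticalFun F) :
    IsArithmeticalFun fun v => f.eval (F v) := by
  induction f using Polynomial.induction_on' with
  | add f g hf hg => simpa only [Polynomial.eval_add] using hf.add hg
  | monomial n a =>
    simp only [Polynomial.eval_monomial]
    refine (const a).mul ?_
    induction n with
    | zero => simpa only [pow_zero] using const 1
    | succ n ih => simpa only [pow_succ] using ih.mul hF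

namespace arith

theorem exists_formula_fin {γ : Type} {s : Set (γ → NonnegPart M)}
    (hs : (Set.univ : Set (NonnegPart M)).Definable arith s) :
    ∃ (n : ℕ) (c : Fin n → NonnegPart M) (φ : arith.Formula (Fin n ⊕ γ)),
      ∀ v, φ.Realize (Sum.elim c v) ↔ v ∈ s := by
  obtain ⟨A, -, hA⟩ := Set.definable_iff_finitely_definable.1 hs
  obtain ⟨φ, rfl⟩ := Set.definable_iff_exists_formula_sum.1 hA
  refine ⟨A.card, fun i => A.equivFin.symm i, φ.relabel (Sum.map A.equivFin id), fun v => ?_⟩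
  rw [Formula.realize_relabel, Sum.elim_comp_map]
  simp only [Function.comp_def, Equiv.symm_apply_apply]
  rfl

theorem realize_induction_iff {N : Type*} [Zero N] [One N] [Add N] [Mul N] {n : ℕ}
    {φ : arith.Formula (Fin n ⊕ Fin 1)} :
    N ⊨ arith.induction n φ ↔ ∀ c : Fin n → N, φ.Realize (Sum.elim c fun _ => 0) →
      (∀ x : N, φ.Realize (Sum.elim c fun _ => x) → φ.Realize (Sum.elim c fun _ => x + 1)) →
      ∀ x : N, φ.Realize (Sum.elim c fun _ => x) := by
  have zero_eq (c : Fin n → N) :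
      (fun a : Fin n ⊕ Fin 1 => (Sum.elim (fun i => Term.var i)
        (fun _ => arith.tZero) a : arith.Term (Fin n)).realize c) = Sum.elim c fun _ => 0 := by
    ext (_ | _)
    · rfl
    · exact Term.realize_constants (L := arith)
  have succ_eq (w : Fin n ⊕ Fin 1 → N) :
      (fun a : Fin n ⊕ Fin 1 => (Sum.elim (fun i => Term.var (.inl i))
        (fun j => arith.tAdd (.var (.inr j)) arith.tOne) a :
          arith.Term (Fin n ⊕ Fin 1)).realize w) =
        Sum.elim (w ∘ .inl) fun j => w (.inr j) + 1 := by
    ext (i | i)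
    · rfl
    · exact (Term.realize_functions_apply₂ (L := arith)).trans
        (congrArg _ (Term.realize_constants (L := arith)))
  simp only [Sentence.Realize, arith.induction, Formula.realize_iAlls, Formula.realize_relabel,
    Formula.realize_imp]
  refine forall_congr' fun c => ?_
  simp only [Formula.Realize, BoundedFormula.realize_subst, zero_eq, succ_eq,
    (Equiv.funUnique (Fin 1) N).forall_congr_left]
  rfl

end arith

theorem IsPeanoRing.induction (hM : IsPeanoRing M) {P : M → Prop}
    (hP : IsArithmetical fun v : Unit → M => P (v ())) (zero : P 0)
    (succ : ∀ x, 0 ≤ x → P x → P (x + 1)) (x : M) (hx : 0 ≤ x) : P x := by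
  have hP' : (Set.univ : Set (NonnegPart M)).Definable arith
      {v : Fin 1 → NonnegPart M | P (v 0)} := by
    simpa using! hP.preimage_map (F := fun v a => bif a.2 then v 0 else 0) fun a => by
      cases h : a.2 <;> simp only [h, cond] <;> fun_prop (disch := trivial)
  obtain ⟨n, c, φ, hφ⟩ := arith.exists_formula_fin hP'
  have key := arith.realize_induction_iff.1 (hM.realize_of_mem _ (Or.inr ⟨n, φ, rfl⟩)) c
  simp only [hφ] at key
  exact key zero (fun y => succ y y.2) ⟨x, hx⟩

end Definability

/-! ### The beta function and exponentiation -/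

section PeanoArithmetic

variable {M : Type u} [CommRing M] [LinearOrder M]

theorem IsRem.congr {a a' m r : M} (h : IsRem a m r) (ha : m ∣ a' - a) : IsRem a' m r :=
  ⟨h.1, h.2.1, by simpa only [sub_add_sub_cancel] using dvd_add ha h.2.2⟩

variable [IsStrictOrderedRing M]

namespace IsPeanoRing

variable (hM : IsPeanoRing M)
include hM

theorem one_le_of_pos {x : M} (hx : 0 < x) : 1 ≤ x :=
  hM.induction (P := fun x => 0 < x → 1 ≤ x) (by fun_prop) (fun h => absurd h (lt_irrefl 0))
    (fun x hx _ _ => le_add_of_nonneg_left hx) x hx.le hx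

theorem add_one_le_iff {x y : M} : x + 1 ≤ y ↔ x < y :=
  ⟨fun h => (lt_add_one x).trans_le h, fun h => by
    linarith only [hM.one_le_of_pos (sub_pos.2 h)]⟩

theorem lt_add_one_iff {x y : M} : x < y + 1 ↔ x ≤ y := by
  rw [← hM.add_one_le_iff, add_le_add_iff_right]

theorem le_of_dvd {x y : M} (hy : 0 < y) (h : x ∣ y) : x ≤ y := by
  obtain ⟨t, rfl⟩ := h
  rcases le_or_gt x 0 with hx | hx
  · exact hx.trans hy.le
  · exact le_mul_of_one_le_right hx.le (hM.one_le_of_pos (pos_of_mul_pos_right hy hx.le))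

theorem exists_isRem (a : M) {m : M} (hm : 0 < m) : ∃ r, IsRem a m r := by
  have of_nonneg : ∀ a, 0 ≤ a → ∃ r, IsRem a m r := by
    refine hM.induction (by unfold IsRem; fun_prop)
      ⟨0, le_rfl, hm, (sub_self (0 : M)).symm ▸ dvd_zero m⟩ ?_
    rintro x - ⟨r, hr0, hrm, hdvd⟩
    rcases (hM.add_one_le_iff.2 hrm).lt_or_eq with hlt | rfl
    · exact ⟨r + 1, by positivity, hlt, by rwa [add_sub_add_right_eq_sub]⟩
    · refine ⟨0, le_rfl, hm, ?_⟩
      convert dvd_add_self_right.2 hdvd using 1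
      ring
  obtain ⟨r, hr⟩ := of_nonneg (a + |a| * m) <| by
    linarith only [neg_abs_le a, mul_le_mul_of_nonneg_left (hM.one_le_of_pos hm) (abs_nonneg a)]
  exact ⟨r, hr.congr ⟨-|a|, by ring⟩⟩

theorem isRem_unique {a m r r' : M} (h : IsRem a m r) (h' : IsRem a m r') : r = r' := by
  wlog hlt : r < r' generalizing r r'
  · exact (not_lt.1 hlt).eq_or_lt.elim Eq.symm fun hlt => (this h' h hlt).symm
  have hdvd : m ∣ r' - r := by simpa only [sub_sub_sub_cancel_left] using dvd_sub h.2.2 h'.2.2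
  linarith only [h.1, h'.2.1, hM.le_of_dvd (sub_pos.2 hlt) hdvd]

theorem exists_forall_dvd {n : M} (hn : 0 ≤ n) : ∃ b, 0 < b ∧ ∀ j, 0 < j → j ≤ n → j ∣ b := by
  refine hM.induction (P := fun n => ∃ b, 0 < b ∧ ∀ j, 0 < j → j ≤ n → j ∣ b) (by fun_prop)
    ⟨1, one_pos, fun j h h' => absurd h' h.not_ge⟩ ?_ n hn
  rintro n hn ⟨b, hb, hdvd⟩
  refine ⟨b * (n + 1), by positivity, fun j hj hjn => ?_⟩
  rcases hjn.lt_or_eq with hlt | rfl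
  · exact (hdvd j hj (hM.lt_add_one_iff.1 hlt)).mul_right _
  · exact dvd_mul_left _ _

theorem exists_dvd_sub_of_isCoprime {c m : M} (h : IsCoprime c m) (hc : 0 < c) (hm : 0 < m)
    (x y : M) : ∃ a, 0 ≤ a ∧ c ∣ a - x ∧ m ∣ a - y := by
  obtain ⟨u, v, huv⟩ := h
  obtain ⟨a, ha, -, t, ht⟩ := hM.exists_isRem (x + c * u * (y - x)) (mul_pos hc hm)
  exact ⟨a, ha, ⟨u * (y - x) - m * t, by linear_combination -ht⟩,
    ⟨v * (x - y) - c * t, by linear_combination -ht + (y - x) * huv⟩⟩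

theorem exists_forall_dvd_sub {m : M → M} (hm : IsArithmeticalFun fun v : Unit → M => m (v ()))
    {P : M → M → Prop} (hP : IsArithmetical fun v : Fin 2 → M => P (v 0) (v 1)) {k : M}
    (hk : 0 ≤ k) (hpos : ∀ i, 0 ≤ i → 0 < m i)
    (hcoprime : ∀ i j, 0 ≤ i → i < j → j < k → IsCoprime (m i) (m j))
    (hex : ∀ i, 0 ≤ i → i < k → ∃ x, P i x) :
    ∃ a, 0 ≤ a ∧ ∀ i, 0 ≤ i → i < k → ∃ x, P i x ∧ m i ∣ a - x := by
  -- `c` replaces the product of the first `n` moduli, which need not be available in `M` as such.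
  have key := hM.induction (P := fun n => n ≤ k → ∃ a c, 0 ≤ a ∧ 0 < c ∧
    (∀ i, 0 ≤ i → i < n → m i ∣ c ∧ ∃ x, P i x ∧ m i ∣ a - x) ∧
    (∀ j, n ≤ j → j < k → IsCoprime c (m j))) ?_ ?_ ?_ k hk le_rfl
  · obtain ⟨a, _, ha, -, h, -⟩ := key
    exact ⟨a, ha, fun i hi hik => (h i hi hik).2⟩
  · have hm' {γ : Type} (c : γ) : IsArithmeticalFun fun v : γ → M => m (v c) :=
      hm.comp (G := fun v _ => v c) fun _ => .var c
    exact .imp (by fun_prop) <| .ex <| .ex <| .and (by fun_prop) <| .and (by fun_prop) <| .and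
      (.all <| .imp (by fun_prop) <| .imp (by fun_prop) <| .and (.dvd (hm' _) (by fun_prop)) <|
        .ex <| .and (hP.comp₂ (by fun_prop) (by fun_prop)) (.dvd (hm' _) (by fun_prop)))
      (.all <| .imp (by fun_prop) <| .imp (by fun_prop) <| .isCoprime (by fun_prop) (hm' _))
  · exact fun _ => ⟨0, 1, le_rfl, one_pos, fun i h h' => absurd h' h.not_gt,
      fun _ _ _ => isCoprime_one_left⟩
  · intro n hn ih hnk
    have hnk' : n < k := hM.add_one_le_iff.1 hnk
    obtain ⟨a, c, -, hc, hac, hcop⟩ := ih hnk'.le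
    obtain ⟨x, hx⟩ := hex n hn hnk'
    obtain ⟨a', ha', hca, hma⟩ :=
      hM.exists_dvd_sub_of_isCoprime (hcop n le_rfl hnk') hc (hpos n hn) a x
    refine ⟨a', c * m n, ha', mul_pos hc (hpos n hn), fun i hi hin => ?_, fun j hj hjk => ?_⟩
    · rcases (hM.lt_add_one_iff.1 hin).lt_or_eq with hlt | rfl
      · obtain ⟨hic, y, hy, hiy⟩ := hac i hi hlt
        exact ⟨hic.mul_right _, y, hy, sub_add_sub_cancel a' a y ▸ dvd_add (hic.trans hca) hiy⟩
      · exact ⟨dvd_mul_left _ _, x, hx, hma⟩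
    · have hnj : n < j := hM.add_one_le_iff.1 hj
      exact (hcop j hnj.le hjk).mul_left (hcoprime n j hn hnj hjk)

theorem exists_forall_exists_le {P : M → M → Prop}
    (hP : IsArithmetical fun v : Fin 2 → M => P (v 0) (v 1)) {k : M} (hk : 0 ≤ k)
    (hex : ∀ i, 0 ≤ i → i < k → ∃ x, P i x) :
    ∃ B, 0 ≤ B ∧ ∀ i, 0 ≤ i → i < k → ∃ x ≤ B, P i x := by
  refine hM.induction (P := fun n => n ≤ k → ∃ B, 0 ≤ B ∧ ∀ i, 0 ≤ i → i < n → ∃ x, x ≤ B ∧ P i x)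
    ?_ (fun _ => ⟨0, le_rfl, fun i h h' => absurd h' h.not_gt⟩) (fun n hn ih hnk => ?_) k hk le_rfl
  · exact .imp (by fun_prop) <| .ex <| .and (by fun_prop) <| .all <| .imp (by fun_prop) <|
      .imp (by fun_prop) <| .ex <| .and (by fun_prop) (hP.comp₂ (by fun_prop) (by fun_prop))
  · have hnk' : n < k := hM.add_one_le_iff.1 hnk
    obtain ⟨B, hB, h⟩ := ih hnk'.le
    obtain ⟨x, hx⟩ := hex n hn hnk'
    refine ⟨max B x, le_max_of_le_left hB, fun i hi hin => ?_⟩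
    rcases (hM.lt_add_one_iff.1 hin).lt_or_eq with hlt | rfl
    · obtain ⟨y, hy, hPy⟩ := h i hi hlt
      exact ⟨y, le_max_of_le_left hy, hPy⟩
    · exact ⟨x, le_max_right _ _, hx⟩

omit hM in
theorem isCoprime_beta_moduli {b k i j : M} (hb : ∀ j, 0 < j → j ≤ k → j ∣ b) (hi : 0 ≤ i)
    (hij : i < j) (hj : j ≤ k) : IsCoprime (1 + (i + 1) * b) (1 + (j + 1) * b) := by
  have h : IsCoprime (1 + (i + 1) * b) b := ⟨1, -(i + 1), by ring⟩
  have hsub : IsCoprime (1 + (i + 1) * b) (j - i) :=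
    h.of_isCoprime_of_dvd_right (hb _ (sub_pos.2 hij) ((sub_le_self j hi).trans hj))
  convert (h.mul_right hsub).add_mul_left_right 1 using 1
  ring

theorem exists_forall_isBeta {P : M → M → Prop}
    (hP : IsArithmetical fun v : Fin 2 → M => P (v 0) (v 1)) {k : M} (hk : 0 ≤ k)
    (hex : ∀ i, 0 ≤ i → i < k → ∃ x, 0 ≤ x ∧ P i x) :
    ∃ a b, 0 ≤ a ∧ 0 ≤ b ∧ ∀ i, 0 ≤ i → i < k → ∃ x, P i x ∧ IsBeta a b i x := by
  obtain ⟨B, hB, hPB⟩ := hM.exists_forall_exists_le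
    (P := fun i x => 0 ≤ x ∧ P i x) (.and (by fun_prop) hP) hk hex
  obtain ⟨d, hd, hdvd⟩ := hM.exists_forall_dvd hk
  set b := d * (B + 1) with hb
  have hBb : B < b := by nlinarith only [hM.one_le_of_pos hd, hB, hb]
  have hmod (i : M) (hi : 0 ≤ i) : B < 1 + (i + 1) * b := by
    nlinarith only [mul_nonneg hi (hB.trans hBb.le), hBb]
  obtain ⟨a, ha, h⟩ := hM.exists_forall_dvd_sub (m := fun i => 1 + (i + 1) * b)
    (P := fun i x => (0 ≤ x ∧ x ≤ B) ∧ P i x) (by fun_prop) (.and (by fun_prop) hP) hk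
    (fun i hi => hB.trans_lt (hmod i hi))
    (fun i j hi hij hjk =>
      isCoprime_beta_moduli (fun l hl hlk => (hdvd l hl hlk).mul_right _) hi hij hjk.le)
    fun i hi hik => (hPB i hi hik).imp fun x ⟨hxB, hx0, hx⟩ => ⟨⟨hx0, hxB⟩, hx⟩
  refine ⟨a, b, ha, hB.trans hBb.le, fun i hi hik => ?_⟩
  obtain ⟨x, ⟨⟨hx0, hxB⟩, hx⟩, hdvd⟩ := h i hi hik
  exact ⟨x, hx, hx0, hxB.trans_lt (hmod i hi), hdvd⟩

theorem exists_isBeta_extension {a b k x : M} (hb : 0 ≤ b) (hk : 0 ≤ k) (hx : 0 ≤ x) :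
    ∃ a' b', 0 ≤ a' ∧ 0 ≤ b' ∧ (∀ i, 0 ≤ i → i < k → ∀ r, IsBeta a b i r → IsBeta a' b' i r) ∧
      IsBeta a' b' k x := by
  have hex (i : M) (hi : 0 ≤ i) (hik : i < k + 1) :
      ∃ y, 0 ≤ y ∧ (i < k → IsBeta a b i y) ∧ (i = k → y = x) := by
    rcases (hM.lt_add_one_iff.1 hik).lt_or_eq with hlt | rfl
    · obtain ⟨y, hy⟩ := hM.exists_isRem a (by positivity : 0 < 1 + (i + 1) * b)
      exact ⟨y, hy.1, fun _ => hy, fun h => absurd h hlt.ne⟩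
    · exact ⟨x, hx, fun h => absurd h (lt_irrefl i), fun _ => rfl⟩
  obtain ⟨a', b', ha', hb', h⟩ := hM.exists_forall_isBeta (by fun_prop) (by positivity) hex
  refine ⟨a', b', ha', hb', fun i hi hik r hr => ?_, ?_⟩
  · obtain ⟨y, ⟨hy, -⟩, hy'⟩ := h i hi (hik.trans (lt_add_one k))
    rwa [hM.isRem_unique hr (hy hik)]
  · obtain ⟨y, ⟨-, hy⟩, hy'⟩ := h k hk (lt_add_one k)
    rwa [← hy rfl]

omit hM in
theorem isPow_zero (p : M) : IsPow p 0 1 :=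
  ⟨1, 1, zero_le_one, zero_le_one, ⟨zero_le_one, by norm_num, by simp⟩,
    fun _ h h' => absurd h' h.not_gt, ⟨zero_le_one, by norm_num, by simp⟩⟩

theorem isPow_zero_iff {p q : M} : IsPow p 0 q ↔ q = 1 := by
  refine ⟨?_, fun h => h ▸ isPow_zero p⟩
  rintro ⟨a, b, -, -, h, -, h'⟩
  exact hM.isRem_unique h' h

theorem isPow_add_one_iff {p k q : M} (hp : 0 ≤ p) (hk : 0 ≤ k) :
    IsPow p (k + 1) q ↔ ∃ r, IsPow p k r ∧ q = p * r := by
  constructor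
  · rintro ⟨a, b, ha, hb, h0, hstep, hq⟩
    obtain ⟨r, hr, hpr⟩ := hstep k hk (lt_add_one k)
    exact ⟨r, ⟨a, b, ha, hb, h0, fun i hi hik => hstep i hi (hik.trans (lt_add_one k)), hr⟩,
      hM.isRem_unique hq hpr⟩
  · rintro ⟨r, ⟨a, b, -, hb, h0, hstep, hr⟩, rfl⟩
    have hk1 : 0 < k + 1 := by positivity
    obtain ⟨a', b', ha', hb', h, hpr⟩ :=
      hM.exists_isBeta_extension (a := a) hb hk1.le (mul_nonneg hp hr.1)
    refine ⟨a', b', ha', hb', h 0 le_rfl hk1 1 h0, fun i hi hik => ?_, hpr⟩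
    rcases (hM.lt_add_one_iff.1 hik).lt_or_eq with hlt | rfl
    · obtain ⟨s, hs, hps⟩ := hstep i hi hlt
      exact ⟨s, h i hi hik s hs, h (i + 1) (by positivity) (add_lt_add_left hlt 1) _ hps⟩
    · exact ⟨r, h i hi hik r hr, hpr⟩

theorem existsUnique_isPow {p k : M} (hp : 0 ≤ p) (hk : 0 ≤ k) : ∃! q, IsPow p k q := by
  refine hM.induction (P := fun k => ∃ q, IsPow p k q ∧ ∀ q', IsPow p k q' → q' = q)
    (by unfold IsPow; fun_prop) ⟨1, isPow_zero p, fun _ => hM.isPow_zero_iff.1⟩ ?_ k hk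
  rintro k hk ⟨q, hq, hq_unique⟩
  refine ⟨p * q, (hM.isPow_add_one_iff hp hk).2 ⟨q, hq, rfl⟩, fun q' hq' => ?_⟩
  obtain ⟨r, hr, rfl⟩ := (hM.isPow_add_one_iff hp hk).1 hq'
  rw [hq_unique r hr]

end IsPeanoRing

end PeanoArithmetic

section StandardNumbers

variable {M : Type u} [CommRing M] [LinearOrder M] [IsStrictOrderedRing M]

namespace IsPeanoRing

variable (hM : IsPeanoRing M)
include hM

theorem isLeast_pos_one : IsLeast {x : M | 0 < x} 1 :=
  ⟨one_pos, fun _ => hM.one_le_of_pos⟩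

theorem exists_eq_natCast {x : M} (hx : 0 ≤ x) {n : ℕ} (h : x ≤ n) : ∃ m : ℕ, x = m := by
  induction n with
  | zero => exact ⟨0, by rw [Nat.cast_zero] at h ⊢; exact le_antisymm h hx⟩
  | succ n ih =>
    rcases h.lt_or_eq with h | h
    · rw [Nat.cast_add_one, hM.lt_add_one_iff] at h
      exact ih h
    · exact ⟨n + 1, h⟩

theorem isPresburgerGroup : IsPresburgerGroup M := by
  refine ⟨1, hM.isLeast_pos_one, fun n hn x => ?_⟩
  obtain ⟨r, hr0, hrn, y, hy⟩ := hM.exists_isRem x (Nat.cast_pos.2 hn : (0 : M) < n)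
  obtain ⟨r, rfl⟩ := hM.exists_eq_natCast hr0 hrn.le
  refine ⟨y, r, Nat.cast_lt.1 hrn, ?_⟩
  rw [nsmul_eq_mul, nsmul_one, ← hy, sub_add_cancel]

theorem natCast_prime_eq {p : M} (hp0 : 0 ≤ p) (hp : Prime p) {ℓ : ℕ} (hℓ : ℓ.Prime)
    (h : p ∣ (ℓ : M)) : (ℓ : M) = p := by
  have hℓ0 : (0 : M) < ℓ := Nat.cast_pos.2 hℓ.pos
  obtain ⟨m, rfl⟩ := hM.exists_eq_natCast hp0 (hM.le_of_dvd hℓ0 h)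
  obtain ⟨c, hc⟩ := h
  have hc0 : 0 ≤ c := (pos_of_mul_pos_right (hc ▸ hℓ0) hp0).le
  obtain ⟨d, rfl⟩ := hM.exists_eq_natCast hc0 (hM.le_of_dvd hℓ0 (Dvd.intro_left _ hc.symm))
  rw [← Nat.cast_mul, Nat.cast_inj] at hc
  rcases (Nat.dvd_prime hℓ).1 (Dvd.intro _ hc.symm) with rfl | rfl
  · exact absurd Nat.cast_one hp.ne_one
  · rfl

end IsPeanoRing

end StandardNumbers

section Exponential

variable {M : Type u} [CommRing M] [LinearOrder M]

open Classical in
/-- The exponential function `p ^ k` of a model of Peano Arithmetic as a total function; its value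
is `0` at negative `k`. -/
noncomputable def peanoPow (p k : M) : M :=
  if h : 0 ≤ k ∧ ∃ q, IsPow p k q then h.2.choose else 0

variable [IsStrictOrderedRing M]

theorem IsPeanoRing.isPow_iff_eq_peanoPow (hM : IsPeanoRing M) {p k q : M} (hp : 0 ≤ p)
    (hk : 0 ≤ k) :
    IsPow p k q ↔ q = peanoPow p k := by
  have hpow := hM.existsUnique_isPow hp hk
  rw [peanoPow, dif_pos ⟨hk, hpow.exists⟩]
  exact ⟨fun h => hpow.unique h hpow.exists.choose_spec, fun h => h ▸ hpow.exists.choose_spec⟩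

theorem IsPeanoRing.eq_peanoPow_iff (hM : IsPeanoRing M) {p k q : M} (hp : 0 ≤ p) :
    q = peanoPow p k ↔ (0 ≤ k → IsPow p k q) ∧ (k < 0 → q = 0) := by
  rcases le_or_gt 0 k with hk | hk
  · simp only [hk, hk.not_gt, forall_const, IsEmpty.forall_iff, and_true,
      hM.isPow_iff_eq_peanoPow hp]
  · simp only [peanoPow, hk.not_ge, hk, false_and, dite_false, forall_const, IsEmpty.forall_iff,
      true_and]

@[fun_prop]
theorem IsArithmeticalFun.peanoPow {α : Type} (hM : IsPeanoRing M) {p : M} (hp : 0 ≤ p)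
    {F : (α → M) → M} (hF : IsArithmeticalFun F) :
    IsArithmeticalFun fun v => peanoPow p (F v) := by
  have h : IsArithmeticalFun fun v : Unit → M => _root_.peanoPow p (v ()) := by
    unfold IsArithmeticalFun
    simp only [hM.eq_peanoPow_iff hp]
    unfold IsPow
    fun_prop
  exact h.comp (G := fun v _ => F v) fun _ => hF

namespace IsPeanoRing

variable (hM : IsPeanoRing M) {p : M}
include hM

section Nonneg

variable (hp : 0 ≤ p)
include hp

theorem peanoPow_zero : peanoPow p 0 = 1 :=
  ((hM.isPow_iff_eq_peanoPow hp le_rfl).1 (isPow_zero p)).symm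

theorem peanoPow_add_one {k : M} (hk : 0 ≤ k) : peanoPow p (k + 1) = p * peanoPow p k := by
  rw [eq_comm, ← hM.isPow_iff_eq_peanoPow hp (by positivity), hM.isPow_add_one_iff hp hk]
  exact ⟨_, (hM.isPow_iff_eq_peanoPow hp hk).2 rfl, rfl⟩

theorem peanoPow_one : peanoPow p 1 = p := by
  rw [← zero_add 1, hM.peanoPow_add_one hp le_rfl, hM.peanoPow_zero hp, mul_one]

theorem peanoPow_add {m n : M} (hm : 0 ≤ m) (hn : 0 ≤ n) :
    peanoPow p (m + n) = peanoPow p m * peanoPow p n := by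
  refine hM.induction (P := fun n => peanoPow p (m + n) = peanoPow p m * peanoPow p n)
    (by fun_prop (disch := assumption)) ?_ (fun n hn ih => ?_) n hn
  · rw [add_zero, hM.peanoPow_zero hp, mul_one]
  · rw [← add_assoc, hM.peanoPow_add_one hp (add_nonneg hm hn), ih, hM.peanoPow_add_one hp hn,
      mul_left_comm]

theorem peanoPow_dvd_peanoPow {m n : M} (hm : 0 ≤ m) (h : m ≤ n) : peanoPow p m ∣ peanoPow p n :=
  ⟨peanoPow p (n - m), by rw [← hM.peanoPow_add hp hm (sub_nonneg.2 h), add_sub_cancel]⟩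

theorem isCoprime_peanoPow {u n : M} (hu : IsCoprime u p) (hn : 0 ≤ n) :
    IsCoprime u (peanoPow p n) := by
  refine hM.induction (P := fun n => IsCoprime u (peanoPow p n))
    (by fun_prop (disch := assumption)) ?_ (fun n hn ih => ?_) n hn
  · rw [hM.peanoPow_zero hp]
    exact isCoprime_one_right
  · rw [hM.peanoPow_add_one hp hn]
    exact hu.mul_right ih

theorem exists_peanoPow_dvd_eval (f : Polynomial M) {a n : M} (ha : p ∣ f.eval a)
    (ha' : IsCoprime (f.derivative.eval a) p) (hn : 0 ≤ n) :
    ∃ x, p ∣ x - a ∧ peanoPow p (n + 1) ∣ f.eval x := by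
  refine hM.induction (P := fun n => ∃ x, p ∣ x - a ∧ peanoPow p (n + 1) ∣ f.eval x)
    (by fun_prop (disch := assumption))
    ⟨a, by rw [sub_self]; exact dvd_zero p, by rwa [zero_add, hM.peanoPow_one hp]⟩ ?_ n hn
  rintro n hn ⟨x, hx, t, ht⟩
  obtain ⟨u, v, huv⟩ : IsCoprime (f.derivative.eval x) p := by
    obtain ⟨c, hc⟩ := hx.trans (Polynomial.sub_dvd_eval_sub x a f.derivative)
    rw [sub_eq_iff_eq_add'.1 hc]
    exact ha'.add_mul_left_left c
  set q := peanoPow p n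
  have hq : peanoPow p (n + 1) = p * q := hM.peanoPow_add_one hp hn
  obtain ⟨g, hg⟩ := f.binomExpansion x (-(u * t) * (p * q))
  rw [hq] at ht
  rw [hM.peanoPow_add_one hp (by positivity : 0 ≤ n + 1), hq]
  -- The Newton step `x - f x / f' x`, with `u` inverting `f' x` modulo `p`.
  refine ⟨x + -(u * t) * (p * q), ?_, v * t + g * (u * t) ^ 2 * q, ?_⟩
  · rw [add_sub_right_comm]
    exact dvd_add hx ⟨-(u * t) * q, by ring⟩
  · rw [hg, ht]
    linear_combination p * q * t * -huv

end Nonneg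

section OneLt

variable (hp : 1 < p)
include hp

theorem lt_peanoPow {n : M} (hn : 0 ≤ n) : n < peanoPow p n := by
  have hp0 : 0 ≤ p := zero_le_one.trans hp.le
  refine hM.induction (P := fun n => n < peanoPow p n)
    (by fun_prop (disch := assumption)) ?_ (fun n hn ih => ?_) n hn
  · rw [hM.peanoPow_zero hp0]
    exact one_pos
  · rw [hM.peanoPow_add_one hp0 hn]
    nlinarith only [hM.add_one_le_iff.2 hp, hM.add_one_le_iff.2 ih, hn]

theorem peanoPow_pos {n : M} (hn : 0 ≤ n) : 0 < peanoPow p n :=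
  hn.trans_lt (hM.lt_peanoPow hp hn)

theorem eq_zero_of_forall_peanoPow_dvd {x : M} (h : ∀ n, 0 ≤ n → peanoPow p n ∣ x) : x = 0 := by
  by_contra hx
  exact (hM.lt_peanoPow hp (abs_nonneg x)).not_ge
    (hM.le_of_dvd (abs_pos.2 hx) ((dvd_abs _ _).2 (h _ (abs_nonneg x))))

theorem exists_eq_peanoPow_mul {x : M} (hx : x ≠ 0) :
    ∃ n u, 0 ≤ n ∧ x = peanoPow p n * u ∧ ¬ p ∣ u := by
  have hp0 : 0 ≤ p := zero_le_one.trans hp.le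
  by_contra! h
  refine hx (hM.eq_zero_of_forall_peanoPow_dvd hp
    (hM.induction (by fun_prop (disch := assumption)) ?_ ?_))
  · rw [hM.peanoPow_zero hp0]
    exact one_dvd x
  · rintro n hn ⟨u, hu⟩
    obtain ⟨v, rfl⟩ := h n u hn hu
    exact ⟨v, by rw [hu, hM.peanoPow_add_one hp0 hn, mul_left_comm, mul_assoc]⟩

theorem peanoPow_dvd_peanoPow_iff {m n : M} (hm : 0 ≤ m) (hn : 0 ≤ n) :
    peanoPow p m ∣ peanoPow p n ↔ m ≤ n := by
  have hp0 : 0 ≤ p := zero_le_one.trans hp.le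
  refine ⟨fun h => ?_, hM.peanoPow_dvd_peanoPow hp0 hm⟩
  by_contra! hlt
  have hq := hM.peanoPow_pos hp hn
  have hle : p * peanoPow p n ≤ peanoPow p n := by
    rw [← hM.peanoPow_add_one hp0 hn]
    exact hM.le_of_dvd hq
      ((hM.peanoPow_dvd_peanoPow hp0 (by positivity) (hM.add_one_le_iff.2 hlt)).trans h)
  exact (lt_mul_of_one_lt_left hq hp).not_ge hle

end OneLt

section Prime

variable (hp : Prime p)
include hp

theorem isCoprime_prime_of_lt {x : M} (hx : 0 < x) (hxp : x < p) : IsCoprime x p := by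
  refine hM.induction (P := fun n => ∀ x, 0 < x → x ≤ n → x < p → IsCoprime x p) (by fun_prop)
    (fun x hx hx' => absurd hx' hx.not_ge) (fun n _ ih x hx hxn hxp => ?_) x hx.le x hx le_rfl hxp
  obtain ⟨r, hr0, hrx, t, ht⟩ := hM.exists_isRem p hx
  obtain rfl | hr := hr0.eq_or_lt
  · have hdvd : x ∣ p := ⟨t, by rw [← ht, sub_zero]⟩
    rcases hp.irreducible.dvd_iff.1 hdvd with hunit | hassoc
    · exact isCoprime_one_left.of_isCoprime_of_dvd_left (isUnit_iff_dvd_one.1 hunit)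
    · exact absurd (hM.le_of_dvd hx hassoc.dvd) hxp.not_ge
  · obtain ⟨a, b, hab⟩ := ih r hr (hM.lt_add_one_iff.1 (hrx.trans_le hxn)) (hrx.trans hxp)
    exact ⟨-(a * t), a + b, by linear_combination hab + a * ht⟩

variable (hp0 : 0 ≤ p)
include hp0

theorem one_lt_of_prime : 1 < p :=
  (hM.one_le_of_pos (hp0.lt_of_ne' hp.ne_zero)).lt_of_ne fun h => hp.not_isUnit (h ▸ isUnit_one)

theorem isCoprime_prime_iff {u : M} : IsCoprime u p ↔ ¬ p ∣ u := by
  refine ⟨fun h hdvd => hp.not_isUnit (h.isUnit_of_dvd' hdvd dvd_rfl), fun hu => ?_⟩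
  obtain ⟨r, hr0, hrp, t, ht⟩ := hM.exists_isRem u (hp0.lt_of_ne' hp.ne_zero)
  have hr : 0 < r := hr0.lt_of_ne <| by
    rintro rfl
    exact hu ⟨t, by rw [← ht, sub_zero]⟩
  rw [sub_eq_iff_eq_add'.1 ht]
  exact (hM.isCoprime_prime_of_lt hp hr hrp).add_mul_left_left t

end Prime

end IsPeanoRing

end Exponential

/-! ### Completion along a submonoid -/

section SubmonoidCompletion

variable {A : Type*} [CommRing A]

/-- The completion of `A` along a submonoid `S`: the inverse limit of the rings `A ⧸ (s)`, for
`s ∈ S` ordered by divisibility. -/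
def SubmonoidCompletion (S : Submonoid A) : Subring (∀ s : S, A ⧸ Ideal.span {(s : A)}) where
  carrier := {x | ∀ (s t : S) (h : (s : A) ∣ t),
    Ideal.Quotient.factor (Ideal.span_singleton_le_span_singleton.2 h) (x t) = x s}
  zero_mem' _ _ _ := map_zero _
  one_mem' _ _ _ := map_one _
  add_mem' hx hy s t h := by rw [Pi.add_apply, map_add, hx s t h, hy s t h, Pi.add_apply]
  mul_mem' hx hy s t h := by rw [Pi.mul_apply, map_mul, hx s t h, hy s t h, Pi.mul_apply]
  neg_mem' hx s t h := by rw [Pi.neg_apply, map_neg, hx s t h, Pi.neg_apply]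

theorem mk_span_singleton_eq_zero_iff {s a : A} :
    Ideal.Quotient.mk (Ideal.span {s}) a = 0 ↔ s ∣ a := by
  rw [Ideal.Quotient.eq_zero_iff_mem, Ideal.mem_span_singleton]

theorem isUnit_mk_span_singleton_iff {s a : A} :
    IsUnit (Ideal.Quotient.mk (Ideal.span {s}) a) ↔ IsCoprime a s := by
  rw [isUnit_iff_exists_inv', Ideal.Quotient.mk_surjective.exists]
  simp only [← map_mul, ← map_one (Ideal.Quotient.mk _), Ideal.Quotient.eq,
    Ideal.mem_span_singleton, IsCoprime]
  exact exists_congr fun b => ⟨fun ⟨c, hc⟩ => ⟨-c, by linear_combination hc⟩,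
    fun ⟨c, hc⟩ => ⟨-c, by linear_combination hc⟩⟩

namespace SubmonoidCompletion

variable {S : Submonoid A}

variable (S) in
/-- The canonical map from `A` to its completion along `S`. -/
def of : A →+* SubmonoidCompletion S :=
  (RingHom.pi fun s : S => Ideal.Quotient.mk (Ideal.span {(s : A)})).codRestrict
    (SubmonoidCompletion S) fun _ _ _ _ => rfl

/-- The projection from the completion along `S` to `A ⧸ (s)`. -/
def eval (s : S) : SubmonoidCompletion S →+* A ⧸ Ideal.span {(s : A)} :=
  (Pi.evalRingHom _ s).comp (SubmonoidCompletion S).subtype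

theorem eval_of (s : S) (a : A) : eval s (of S a) = Ideal.Quotient.mk _ a := rfl

theorem factor_eval {s t : S} (h : (s : A) ∣ t) (x : SubmonoidCompletion S) :
    Ideal.Quotient.factor (Ideal.span_singleton_le_span_singleton.2 h) (eval t x) = eval s x :=
  x.2 s t h

theorem eval_eq_mk_of_dvd {s t : S} (h : (s : A) ∣ t) {x : SubmonoidCompletion S} {a : A}
    (hx : eval t x = Ideal.Quotient.mk _ a) : eval s x = Ideal.Quotient.mk _ a := by
  rw [← factor_eval h, hx, Ideal.Quotient.factor_mk]

theorem ext_eval {x y : SubmonoidCompletion S} (h : ∀ s, eval s x = eval s y) : x = y :=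
  Subtype.ext (funext h)

theorem eval_surjective (s : S) : Function.Surjective (eval s) := fun y =>
  let ⟨a, ha⟩ := Ideal.Quotient.mk_surjective y
  ⟨of S a, ha⟩

theorem exists_forall_eval {Q : ∀ s : S, A ⧸ Ideal.span {(s : A)} → Prop}
    (hQ : ∀ s, ∃! y, Q s y)
    (hfactor : ∀ (s t : S) (h : (s : A) ∣ t) (y : A ⧸ Ideal.span {(t : A)}), Q t y →
      Q s (Ideal.Quotient.factor (Ideal.span_singleton_le_span_singleton.2 h) y)) :
    ∃ x : SubmonoidCompletion S, ∀ s, Q s (eval s x) := by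
  choose y hy hy_unique using hQ
  exact ⟨⟨y, fun s t h => hy_unique s _ (hfactor s t h _ (hy t))⟩, hy⟩

theorem of_dvd_of_eval_eq_zero {s : S} (hs : (s : A) ∈ nonZeroDivisors A)
    {x : SubmonoidCompletion S} (hx : eval s x = 0) : of S s ∣ x := by
  have hunique (t : S) : ∃! y : A ⧸ Ideal.span {(t : A)}, ∃ b, y = Ideal.Quotient.mk _ b ∧
      eval (s * t) x = Ideal.Quotient.mk _ (s * b) := by
    obtain ⟨a, ha⟩ := Ideal.Quotient.mk_surjective (eval (s * t) x)
    obtain ⟨b, rfl⟩ : (s : A) ∣ a := by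
      rw [← mk_span_singleton_eq_zero_iff,
        ← eval_eq_mk_of_dvd (dvd_mul_right (s : A) t : (s : A) ∣ (s * t : S)) ha.symm, hx]
    refine ⟨_, ⟨b, rfl, ha.symm⟩, ?_⟩
    rintro _ ⟨c, rfl, hc⟩
    rw [← ha, Ideal.Quotient.eq, Ideal.mem_span_singleton, ← mul_sub] at hc
    rw [eq_comm, Ideal.Quotient.eq, Ideal.mem_span_singleton]
    exact (dvd_cancel_left_mem_nonZeroDivisors hs).1 hc
  obtain ⟨y, hy⟩ := exists_forall_eval hunique fun t t' h y ⟨b, hy, hb⟩ =>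
    ⟨b, by rw [hy, Ideal.Quotient.factor_mk], eval_eq_mk_of_dvd (mul_dvd_mul_left _ h) hb⟩
  refine ⟨y, ext_eval fun t => ?_⟩
  obtain ⟨b, hb, hxb⟩ := hy t
  rw [map_mul, hb, eval_of, ← map_mul, eval_eq_mk_of_dvd (dvd_mul_left _ _) hxb]

theorem ker_eval {s : S} (hs : (s : A) ∈ nonZeroDivisors A) :
    RingHom.ker (eval s) = Ideal.span {of S s} := by
  ext x
  rw [RingHom.mem_ker, Ideal.mem_span_singleton]
  refine ⟨of_dvd_of_eval_eq_zero hs, ?_⟩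
  rintro ⟨y, rfl⟩
  rw [map_mul, eval_of, mk_span_singleton_eq_zero_iff.2 dvd_rfl, zero_mul]

theorem of_dvd_of_iff {s : S} (hs : (s : A) ∈ nonZeroDivisors A) {a : A} :
    of S s ∣ of S a ↔ (s : A) ∣ a := by
  rw [← Ideal.mem_span_singleton, ← ker_eval hs, RingHom.mem_ker, eval_of,
    mk_span_singleton_eq_zero_iff]

theorem isUnit_iff_forall_eval {x : SubmonoidCompletion S} :
    IsUnit x ↔ ∀ s, IsUnit (eval s x) := by
  refine ⟨fun h s => h.map (eval s), fun h => ?_⟩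
  have hunique (s : S) : ∃! y, eval s x * y = 1 := by
    obtain ⟨y, hy⟩ := (h s).exists_right_inv
    exact ⟨y, hy, fun z hz => (h s).mul_left_cancel (hz.trans hy.symm)⟩
  obtain ⟨y, hy⟩ := exists_forall_eval hunique fun s t hst y hy => by
    rw [← factor_eval hst, ← map_mul, hy, map_one]
  exact IsUnit.of_mul_eq_one y (ext_eval fun s => by rw [map_mul, hy, map_one])

theorem mem_jacobson_iff_forall_eval {x : SubmonoidCompletion S} :
    x ∈ (⊥ : Ideal (SubmonoidCompletion S)).jacobson ↔
      ∀ s : S, eval s x ∈ (⊥ : Ideal (A ⧸ Ideal.span {(s : A)})).jacobson := by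
  have h (s : S) : eval s x ∈ (⊥ : Ideal (A ⧸ Ideal.span {(s : A)})).jacobson ↔
      ∀ y, IsUnit (eval s (x * y + 1)) := by
    rw [Ideal.mem_jacobson_bot, (eval_surjective s).forall]
    exact forall_congr' fun y => by rw [map_add, map_mul, map_one]
  simp only [h]
  rw [Ideal.mem_jacobson_bot, forall_comm]
  exact forall_congr' fun y => isUnit_iff_forall_eval

end SubmonoidCompletion

end SubmonoidCompletion

theorem eq_of_isRoot_of_sub_mem_jacobson_bot {A : Type*} [CommRing A] {f : Polynomial A} {x y : A}
    (hx : f.IsRoot x) (hy : f.IsRoot y) (hxy : x - y ∈ (⊥ : Ideal A).jacobson)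
    (hy' : IsUnit (f.derivative.eval y)) : x = y := by
  obtain ⟨k, hk⟩ := f.binomExpansion y (x - y)
  rw [add_sub_cancel, hx, hy] at hk
  obtain ⟨u, hu⟩ := hy'
  have hunit : IsUnit (f.derivative.eval y + k * (x - y)) := by
    have h := (Ideal.mem_jacobson_bot.1 hxy (k * ↑u⁻¹)).mul u.isUnit
    rwa [add_mul, one_mul, ← mul_assoc, mul_assoc _ _ (u : A), u.inv_mul, mul_one, mul_comm,
      add_comm, hu] at h
  exact sub_eq_zero.1 (hunit.mul_right_eq_zero.1 (by linear_combination -hk))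

theorem map_mem_jacobson_bot_of_surjective {A B : Type*} [CommRing A] [CommRing B] {φ : A →+* B}
    (hφ : Function.Surjective φ) {x : A} (hx : x ∈ (⊥ : Ideal A).jacobson) :
    φ x ∈ (⊥ : Ideal B).jacobson := by
  rw [Ideal.mem_jacobson_bot] at hx ⊢
  refine hφ.forall.2 fun y => ?_
  simpa only [map_add, map_mul, map_one] using (hx y).map φ

theorem existsUnique_isRoot_of_henselianRing {A : Type*} [CommRing A]
    [h : HenselianRing A (⊥ : Ideal A).jacobson] {f : Polynomial A} (hf : f.Monic) {a : A}
    (ha : f.eval a ∈ (⊥ : Ideal A).jacobson) (ha' : IsUnit (f.derivative.eval a)) :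
    ∃! x, f.IsRoot x ∧ x - a ∈ (⊥ : Ideal A).jacobson := by
  obtain ⟨x, hx, hxa⟩ := h.is_henselian f hf a ha (ha'.map _)
  refine ⟨x, ⟨hx, hxa⟩, fun y ⟨hy, hya⟩ => ?_⟩
  refine eq_of_isRoot_of_sub_mem_jacobson_bot hy hx ?_ ?_
  · simpa only [sub_sub_sub_cancel_right] using sub_mem hya hxa
  · have := isLocalHom_of_le_jacobson_bot (⊥ : Ideal A).jacobson le_rfl
    refine (isUnit_map_iff (Ideal.Quotient.mk (⊥ : Ideal A).jacobson) _).1 ?_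
    have h : f.derivative.eval x - f.derivative.eval a ∈ (⊥ : Ideal A).jacobson :=
      Ideal.mem_of_dvd _ (Polynomial.sub_dvd_eval_sub x a f.derivative) hxa
    rw [Ideal.Quotient.eq.2 h]
    exact ha'.map _

theorem SubmonoidCompletion.henselianRing {A : Type*} [CommRing A] {S : Submonoid A}
    (h : ∀ s : S, HenselianRing (A ⧸ Ideal.span {(s : A)}) (⊥ : Ideal _).jacobson) :
    HenselianRing (SubmonoidCompletion S) (⊥ : Ideal _).jacobson where
  jac := le_rfl
  is_henselian f hf a ha ha' := by
    have := isLocalHom_of_le_jacobson_bot (⊥ : Ideal (SubmonoidCompletion S)).jacobson le_rfl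
    rw [isUnit_map_iff] at ha'
    have hunique (s : S) := existsUnique_isRoot_of_henselianRing (hf.map (eval s)) (a := eval s a)
      (by simpa only [Polynomial.eval_map_apply] using
        map_mem_jacobson_bot_of_surjective (eval_surjective s) ha)
      (by simpa only [Polynomial.derivative_map, Polynomial.eval_map_apply] using ha'.map (eval s))
    obtain ⟨x, hx⟩ := exists_forall_eval hunique fun s t hst y ⟨hy, hya⟩ => by
      refine ⟨?_, ?_⟩
      · have hcomp : (Ideal.Quotient.factor (Ideal.span_singleton_le_span_singleton.2 hst)).comp
            (eval t) = eval s := RingHom.ext (factor_eval hst)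
        rw [← hcomp, ← Polynomial.map_map]
        exact hy.map
      · rw [← factor_eval hst, ← map_sub]
        exact map_mem_jacobson_bot_of_surjective (Ideal.Quotient.factor_surjective _) hya
    refine ⟨x, ext_eval fun s => ?_, mem_jacobson_iff_forall_eval.2 fun s => ?_⟩
    · rw [map_zero, ← Polynomial.eval_map_apply]
      exact (hx s).1
    · rw [map_sub]
      exact (hx s).2

theorem henselianLocalRing_of_henselianRing {R : Type*} [CommRing R] [IsLocalRing R]
    [hR : HenselianRing R (⊥ : Ideal R).jacobson] : HenselianLocalRing R where
  is_henselian f hf a ha ha' := by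
    rw [← IsLocalRing.jacobson_eq_maximalIdeal ⊥ bot_ne_top] at ha ⊢
    exact hR.is_henselian f hf a ha (ha'.map _)

section Valuation

variable {A : Type*} [CommRing A]

/-- A submonoid `S` of a domain that is to consist of representatives of the non-negative values of
a valuation on the completion along `S`: it is totally ordered by divisibility in `S`, and every
nonzero element is a member of `S` times an element that is invertible modulo all members of `S`. -/
class IsValuationSubmonoid (S : Submonoid A) : Prop where
  zero_notMem : 0 ∉ S
  exists_not_isUnit : ∃ s ∈ S, ¬ IsUnit s
  total : ∀ s ∈ S, ∀ t ∈ S, (∃ r ∈ S, t = s * r) ∨ ∃ r ∈ S, s = t * r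
  exists_eq_mul : ∀ x ≠ 0, ∃ s ∈ S, ∃ u, x = s * u ∧ ∀ t ∈ S, IsCoprime u t

variable {S : Submonoid A} [hS : IsValuationSubmonoid S]

theorem IsValuationSubmonoid.mem_nonZeroDivisors [IsDomain A] (s : S) :
    (s : A) ∈ nonZeroDivisors A :=
  mem_nonZeroDivisors_of_ne_zero fun h => hS.zero_notMem (h ▸ s.2)

namespace SubmonoidCompletion

theorem isUnit_of_isUnit_eval {r : S} (hr : ¬ IsUnit (r : A)) {y : SubmonoidCompletion S}
    (hy : IsUnit (eval r y)) : IsUnit y := by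
  refine isUnit_iff_forall_eval.2 fun t => ?_
  obtain ⟨c, hc⟩ := Ideal.Quotient.mk_surjective (eval (r * t) y)
  rw [eval_eq_mk_of_dvd (dvd_mul_right (r : A) t : (r : A) ∣ (r * t : S)) hc.symm,
    isUnit_mk_span_singleton_iff] at hy
  rw [eval_eq_mk_of_dvd (dvd_mul_left (t : A) r : (t : A) ∣ (r * t : S)) hc.symm,
    isUnit_mk_span_singleton_iff]
  obtain ⟨s, hs, u, rfl, hu⟩ := hS.exists_eq_mul c <| by
    rintro rfl
    exact hr (isCoprime_zero_left.1 hy)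
  have hsr : IsCoprime s r := hy.of_mul_left_left
  have hs_unit : IsUnit s := by
    rcases hS.total s hs r r.2 with ⟨q, -, hq⟩ | ⟨q, -, rfl⟩
    · exact hsr.isUnit_of_dvd' dvd_rfl ⟨q, hq⟩
    · exact absurd (hsr.isUnit_of_dvd' (dvd_mul_right _ _) dvd_rfl) hr
  exact (isCoprime_one_left.of_isCoprime_of_dvd_left (isUnit_iff_dvd_one.1 hs_unit)).mul_left
    (hu t t.2)

variable [IsDomain A]

theorem of_injective : Function.Injective (of S) := by
  refine (injective_iff_map_eq_zero _).2 fun a ha => ?_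
  by_contra ha0
  obtain ⟨s, hs, u, rfl, hu⟩ := hS.exists_eq_mul a ha0
  obtain ⟨r, hr, hr_unit⟩ := hS.exists_not_isUnit
  have hdvd : s * r ∣ s * u := by
    have h := congrArg (eval (⟨s, hs⟩ * ⟨r, hr⟩)) ha
    rwa [map_zero, eval_of, mk_span_singleton_eq_zero_iff] at h
  rw [dvd_cancel_left_mem_nonZeroDivisors
    (IsValuationSubmonoid.mem_nonZeroDivisors ⟨s, hs⟩)] at hdvd
  exact hr_unit ((hu r hr).isUnit_of_dvd' hdvd dvd_rfl)

theorem exists_eq_of_mul {x : SubmonoidCompletion S} (hx : x ≠ 0) :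
    ∃ s : S, ∃ u, IsUnit u ∧ x = of S s * u := by
  obtain ⟨t, ht⟩ : ∃ t, eval t x ≠ 0 := by
    by_contra! h
    exact hx (ext_eval h)
  obtain ⟨a, ha⟩ := Ideal.Quotient.mk_surjective (eval t x)
  rw [← ha, Ne, mk_span_singleton_eq_zero_iff] at ht
  obtain ⟨s, hs, u, rfl, hu⟩ := hS.exists_eq_mul a fun h => ht (h ▸ dvd_zero _)
  lift s to S using hs
  obtain ⟨r, hr, htr⟩ := (hS.total s s.2 t t.2).resolve_right
    fun ⟨_, _, hq⟩ => ht (hq ▸ (dvd_mul_right _ _).mul_right _)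
  lift r to S using hr
  obtain rfl : t = s * r := Subtype.ext htr
  have hs := IsValuationSubmonoid.mem_nonZeroDivisors s
  have hdvd : (s : A) ∣ (s * r : S) := dvd_mul_right _ _
  obtain ⟨y, rfl⟩ := of_dvd_of_eval_eq_zero hs <| by
    rw [eval_eq_mk_of_dvd hdvd ha.symm, mk_span_singleton_eq_zero_iff]
    exact dvd_mul_right _ _
  refine ⟨s, y, isUnit_of_isUnit_eval (r := r) (fun h => ht ?_) ?_, rfl⟩
  · exact (h.mul_right_dvd (a := (s : A))).2 (dvd_mul_right _ _)
  · obtain ⟨c, hc⟩ := Ideal.Quotient.mk_surjective (eval (s * r) y)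
    rw [map_mul (eval _), ← hc, eval_of, ← map_mul, Ideal.Quotient.eq, Ideal.mem_span_singleton,
      ← mul_sub, Submonoid.coe_mul, dvd_cancel_left_mem_nonZeroDivisors hs,
      ← Ideal.mem_span_singleton, ← Ideal.Quotient.eq] at ha
    rw [eval_eq_mk_of_dvd (dvd_mul_left (r : A) s : (r : A) ∣ (s * r : S)) hc.symm, ← ha,
      isUnit_mk_span_singleton_iff]
    exact hu r r.2

instance : IsDomain (SubmonoidCompletion S) := by
  have : Nontrivial (SubmonoidCompletion S) := of_injective.nontrivial
  have : NoZeroDivisors (SubmonoidCompletion S) := ⟨fun {x y} h => by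
    by_contra! hxy
    obtain ⟨s, u, hu, rfl⟩ := exists_eq_of_mul hxy.1
    obtain ⟨t, v, hv, rfl⟩ := exists_eq_of_mul hxy.2
    rw [mul_mul_mul_comm, (hu.mul hv).mul_left_eq_zero, ← map_mul,
      map_eq_zero_iff _ of_injective] at h
    exact hS.zero_notMem (h ▸ (s * t).2)⟩
  exact NoZeroDivisors.to_isDomain _

instance : ValuationRing (SubmonoidCompletion S) := by
  refine ValuationRing.iff_dvd_total.2 ⟨fun x y => ?_⟩
  rcases eq_or_ne x 0 with rfl | hx
  · exact Or.inr (dvd_zero y)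
  rcases eq_or_ne y 0 with rfl | hy
  · exact Or.inl (dvd_zero x)
  obtain ⟨s, u, hu, rfl⟩ := exists_eq_of_mul hx
  obtain ⟨t, v, hv, rfl⟩ := exists_eq_of_mul hy
  rw [hu.mul_right_dvd, hu.dvd_mul_right, hv.mul_right_dvd, hv.dvd_mul_right]
  exact (hS.total s s.2 t t.2).imp (fun ⟨r, _, h⟩ => map_dvd _ ⟨r, h⟩)
    fun ⟨r, _, h⟩ => map_dvd _ ⟨r, h⟩

instance [CharZero A] : CharZero (SubmonoidCompletion S) :=
  charZero_of_injective_ringHom of_injective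

end SubmonoidCompletion

end Valuation

/-! ### Value groups -/

section AddVal

variable {R : Type u} [CommRing R] [IsDomain R] [ValuationRing R]

theorem addVal_le_iff {x y : R} (hx : x ≠ 0) (hy : y ≠ 0) : addVal x hx ≤ addVal y hy ↔ x ∣ y := by
  refine (Units.val_le_val (α := ValuationRing.ValueGroup R (FractionRing R))).symm.trans ?_
  refine Iff.trans (b := ∃ c : R, c • algebraMap R (FractionRing R) x =
    algebraMap R (FractionRing R) y) Iff.rfl (exists_congr fun c => ?_)
  rw [Algebra.smul_def, ← map_mul, (IsFractionRing.injective R (FractionRing R)).eq_iff, mul_comm,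
    eq_comm]

theorem addVal_mul {x y : R} (hx : x ≠ 0) (hy : y ≠ 0) :
    addVal (x * y) (mul_ne_zero hx hy) = addVal x hx + addVal y hy := by
  refine congrArg (fun u => OrderDual.toDual (Additive.ofMul u)) (Units.ext ?_)
  exact (congrArg (ValuationRing.valuation R (FractionRing R)) (map_mul _ x y)).trans
    (map_mul _ _ _)

theorem addVal_eq_of_associated {x y : R} (hx : x ≠ 0) (hy : y ≠ 0) (h : Associated x y) :
    addVal x hx = addVal y hy :=
  le_antisymm ((addVal_le_iff hx hy).2 h.dvd) ((addVal_le_iff hy hx).2 h.symm.dvd)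

theorem exists_addVal_eq {γ : AddValueGroup R} (hγ : 0 ≤ γ) : ∃ x hx, addVal (x : R) hx = γ := by
  have h : ((Additive.toMul (OrderDual.ofDual γ) : (ValuationRing.ValueGroup R (FractionRing R))ˣ) :
      ValuationRing.ValueGroup R (FractionRing R)) ≤ 1 := hγ
  obtain ⟨y, hy⟩ : ∃ y, ValuationRing.valuation R (FractionRing R) y =
      Additive.toMul (OrderDual.ofDual γ) := Quotient.exists_rep _
  obtain ⟨x, rfl⟩ := (ValuationRing.mem_integer_iff R (FractionRing R) y).1 (by
    rw [Valuation.mem_integer_iff, hy]; exact h)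
  refine ⟨x, ?_, congrArg (fun u => OrderDual.toDual (Additive.ofMul u)) (Units.ext hy)⟩
  rintro rfl
  rw [map_zero, map_zero] at hy
  exact (Units.ne_zero _) hy.symm

end AddVal

section OrderedGroups

variable {G H : Type*} [AddCommGroup G] [LinearOrder G] [AddCommGroup H]

section Extension

variable [IsOrderedAddMonoid G] (ν : {x : G // 0 ≤ x} →+ H)

theorem exists_eq_coe_sub_coe (x : G) : ∃ m n : {x : G // 0 ≤ x}, x = m - n :=
  ⟨⟨x⁺, posPart_nonneg x⟩, ⟨x⁻, negPart_nonneg x⟩, (posPart_sub_negPart x).symm⟩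

theorem map_posPart_sub_map_negPart (m n : {x : G // 0 ≤ x}) :
    ν ⟨(m - n : G)⁺, posPart_nonneg _⟩ - ν ⟨(m - n : G)⁻, negPart_nonneg _⟩ = ν m - ν n := by
  rw [sub_eq_sub_iff_add_eq_add, ← map_add, ← map_add]
  refine congrArg ν (Subtype.ext ?_)
  rw [Nonneg.coe_add, Nonneg.coe_add, ← sub_eq_sub_iff_add_eq_add, posPart_sub_negPart]

/-- The extension to `G` of an additive map defined on the non-negative part of `G`. -/
def nonnegExtend : G →+ H :=
  AddMonoidHom.mk' (fun x => ν ⟨x⁺, posPart_nonneg x⟩ - ν ⟨x⁻, negPart_nonneg x⟩) fun x y => by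
    obtain ⟨a, b, rfl⟩ := exists_eq_coe_sub_coe x
    obtain ⟨c, d, rfl⟩ := exists_eq_coe_sub_coe y
    simp only [sub_add_sub_comm, ← Nonneg.coe_add, map_posPart_sub_map_negPart]
    rw [map_add, map_add]

theorem nonnegExtend_sub (m n : {x : G // 0 ≤ x}) : nonnegExtend ν (m - n) = ν m - ν n :=
  map_posPart_sub_map_negPart ν m n

theorem nonnegExtend_coe (n : {x : G // 0 ≤ x}) : nonnegExtend ν n = ν n := by
  simpa only [Nonneg.coe_zero, sub_zero, map_zero] using nonnegExtend_sub ν n 0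

theorem exists_orderAddMonoidIso_of_nonneg [LinearOrder H] [IsOrderedAddMonoid H]
    (hle : ∀ m n, ν m ≤ ν n ↔ m ≤ n) (hex : ∀ y, 0 ≤ y → ∃ n, ν n = y) :
    ∃ e : G ≃+o H, ∀ n : {x : G // 0 ≤ x}, e n = ν n := by
  have le_iff (x y : G) : nonnegExtend ν x ≤ nonnegExtend ν y ↔ x ≤ y := by
    obtain ⟨a, b, rfl⟩ := exists_eq_coe_sub_coe x
    obtain ⟨c, d, rfl⟩ := exists_eq_coe_sub_coe y
    rw [nonnegExtend_sub, nonnegExtend_sub, sub_le_sub_iff, sub_le_sub_iff, ← map_add, ← map_add,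
      hle]
    exact Iff.rfl
  have injective : Function.Injective (nonnegExtend ν) := fun x y h =>
    le_antisymm ((le_iff x y).1 h.le) ((le_iff y x).1 h.ge)
  have surjective : Function.Surjective (nonnegExtend ν) := fun y => by
    rcases le_total 0 y with hy | hy
    · obtain ⟨n, rfl⟩ := hex y hy
      exact ⟨n, nonnegExtend_coe ν n⟩
    · obtain ⟨n, hn⟩ := hex (-y) (neg_nonneg.2 hy)
      exact ⟨-n, by rw [map_neg, nonnegExtend_coe, hn, neg_neg]⟩
  exact ⟨{ AddEquiv.ofBijective (nonnegExtend ν) ⟨injective, surjective⟩ with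
    map_le_map_iff' := le_iff _ _ }, nonnegExtend_coe ν⟩

end Extension

variable [LinearOrder H]

theorem isLeast_pos_map (e : G ≃+o H) {a : G} (ha : IsLeast {x | 0 < x} a) :
    IsLeast {y | 0 < y} (e a) := by
  have hpos (x : G) : 0 < e x ↔ 0 < x := by rw [← map_zero e, map_lt_map_iff]
  exact ⟨(hpos a).2 ha.1, (EquivLike.surjective e).forall.2 fun x hx =>
    (map_le_map_iff e).2 (ha.2 ((hpos x).1 hx))⟩

theorem isPresburgerGroup_of_orderAddMonoidIso [IsOrderedAddMonoid G] [IsOrderedAddMonoid H]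
    (e : G ≃+o H) (hG : IsPresburgerGroup G) : IsPresburgerGroup H := by
  obtain ⟨a, ha, hdiv⟩ := hG
  refine ⟨e a, isLeast_pos_map e ha, fun n hn => (EquivLike.surjective e).forall.2 fun x => ?_⟩
  obtain ⟨y, r, hr, rfl⟩ := hdiv n hn x
  exact ⟨e y, r, hr, by rw [map_add, map_nsmul, map_nsmul]⟩

end OrderedGroups

theorem segmentIso_of_orderAddMonoidIso {G H : Type u} [AddCommGroup G] [LinearOrder G]
    [AddCommGroup H] [LinearOrder H] (e : G ≃+o H) (k : G) : SegmentIso k (e k) := by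
  rw [SegmentIso, ← map_zero e]
  exact ⟨e.toOrderIso.Icc 0 k, fun x y z h => (map_add e _ _).symm.trans (congrArg e h)⟩

theorem exists_orderAddMonoidIso_addValueGroup {R : Type u} [CommRing R] [IsDomain R]
    [ValuationRing R] {G : Type*} [AddCommGroup G] [LinearOrder G] [IsOrderedAddMonoid G]
    {c : {x : G // 0 ≤ x} → R} (hc : ∀ n, c n ≠ 0) (hadd : ∀ m n, c (m + n) = c m * c n)
    (hdvd : ∀ m n, c m ∣ c n ↔ m ≤ n) (hassoc : ∀ x, x ≠ 0 → ∃ n, Associated (c n) x) :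
    ∃ e : G ≃+o AddValueGroup R, ∀ n : {x : G // 0 ≤ x}, e n = addVal (c n) (hc n) := by
  refine exists_orderAddMonoidIso_of_nonneg
    (AddMonoidHom.mk' (fun n => addVal (c n) (hc n)) fun m n => ?_) (fun m n => ?_) fun γ hγ => ?_
  · rw [← addVal_mul]
    simp only [hadd]
  · exact (addVal_le_iff (hc m) (hc n)).trans (hdvd m n)
  · obtain ⟨x, hx, rfl⟩ := exists_addVal_eq hγ
    obtain ⟨n, hn⟩ := hassoc x hx
    exact ⟨n, addVal_eq_of_associated (hc n) hx hn⟩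

/-! ### The inverse limit of the quotients by the powers of a prime -/

theorem exists_residueField_ringEquiv {R S : Type*} [CommRing R] [IsLocalRing R] [CommRing S]
    [IsLocalRing S] {π : R →+* S} (hπ : Function.Surjective π) {I : Ideal R}
    (hker : RingHom.ker π = I) :
    ∃ (e : (R ⧸ I) ≃+* S) (g : IsLocalRing.ResidueField R ≃+* IsLocalRing.ResidueField S),
      ∀ x, g (IsLocalRing.residue R x) = IsLocalRing.residue S (e (Ideal.Quotient.mk I x)) := by
  let ρ : R →+* IsLocalRing.ResidueField S := (IsLocalRing.residue S).comp π
  have hρ : Function.Surjective ρ := IsLocalRing.residue_surjective.comp hπ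
  have hker' : IsLocalRing.maximalIdeal R = RingHom.ker ρ :=
    (IsLocalRing.eq_maximalIdeal (RingHom.ker_isMaximal_of_surjective ρ hρ)).symm
  exact ⟨(Ideal.quotEquivOfEq hker.symm).trans (RingHom.quotientKerEquivOfSurjective hπ),
    (Ideal.quotEquivOfEq hker').trans (RingHom.quotientKerEquivOfSurjective hρ), fun _ => rfl⟩

section PrimePowers

variable {M : Type u} [CommRing M] [LinearOrder M] [IsStrictOrderedRing M]

namespace IsPeanoRing

variable (hM : IsPeanoRing M) {p : M} (hp0 : 0 ≤ p)

section Quotient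

variable {n : M}
include hM hp0

theorem isCoprime_peanoPow_add_one_iff (hn : 0 ≤ n) {u : M} :
    IsCoprime u (peanoPow p (n + 1)) ↔ IsCoprime u p := by
  refine ⟨fun h => ?_, fun h => hM.isCoprime_peanoPow hp0 h (by positivity)⟩
  rw [hM.peanoPow_add_one hp0 hn] at h
  exact h.of_mul_right_left

theorem mk_mem_jacobson_bot_iff (hp : Prime p) (hn : 0 ≤ n) {a : M} :
    Ideal.Quotient.mk (Ideal.span {peanoPow p (n + 1)}) a ∈ (⊥ : Ideal _).jacobson ↔ p ∣ a := by
  rw [Ideal.mem_jacobson_bot, Ideal.Quotient.mk_surjective.forall]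
  simp only [← map_mul, ← map_one (Ideal.Quotient.mk _), ← map_add, isUnit_mk_span_singleton_iff,
    hM.isCoprime_peanoPow_add_one_iff hp0 hn, hM.isCoprime_prime_iff hp hp0]
  refine ⟨fun h => ?_, fun h b hb => ?_⟩
  · by_contra ha
    obtain ⟨b, c, hbc⟩ := (hM.isCoprime_prime_iff hp hp0).2 ha
    exact h (-b) ⟨c, by linear_combination -hbc⟩
  · exact hp.not_dvd_one ((dvd_add_right (h.mul_right b)).1 hb)

theorem henselianRing_quotient_peanoPow (hp : Prime p) (hn : 0 ≤ n) :
    HenselianRing (M ⧸ Ideal.span {peanoPow p n}) (⊥ : Ideal _).jacobson where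
  jac := le_rfl
  is_henselian f _ a₀ ha ha' := by
    have := isLocalHom_of_le_jacobson_bot
      (⊥ : Ideal (M ⧸ Ideal.span {peanoPow p n})).jacobson le_rfl
    rw [isUnit_map_iff] at ha'
    obtain rfl | hpos := hn.eq_or_lt
    · have : Subsingleton (M ⧸ Ideal.span {peanoPow p 0}) := by
        rw [hM.peanoPow_zero hp0, Ideal.Quotient.subsingleton_iff, Ideal.span_singleton_one]
      exact ⟨a₀, Subsingleton.elim _ _, by rw [sub_self]; exact zero_mem _⟩
    obtain ⟨m, hm, rfl⟩ : ∃ m, 0 ≤ m ∧ n = m + 1 :=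
      ⟨n - 1, sub_nonneg.2 (hM.one_le_of_pos hpos), (sub_add_cancel n 1).symm⟩
    obtain ⟨f, rfl⟩ := Polynomial.map_surjective _ Ideal.Quotient.mk_surjective f
    obtain ⟨a, rfl⟩ := Ideal.Quotient.mk_surjective a₀
    rw [Polynomial.eval_map_apply, hM.mk_mem_jacobson_bot_iff hp0 hp hm] at ha
    rw [Polynomial.derivative_map, Polynomial.eval_map_apply, isUnit_mk_span_singleton_iff,
      hM.isCoprime_peanoPow_add_one_iff hp0 hm] at ha'
    obtain ⟨x, hxa, hx⟩ := hM.exists_peanoPow_dvd_eval hp0 f ha ha' hm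
    refine ⟨Ideal.Quotient.mk _ x, ?_, ?_⟩
    · rwa [Polynomial.IsRoot, Polynomial.eval_map_apply, mk_span_singleton_eq_zero_iff]
    · rwa [← map_sub, hM.mk_mem_jacobson_bot_iff hp0 hp hm]

end Quotient

/-- The powers of `p`, with possibly nonstandard exponents. -/
def powers : Submonoid M where
  carrier := {q | ∃ n, 0 ≤ n ∧ q = peanoPow p n}
  one_mem' := ⟨0, le_rfl, (hM.peanoPow_zero hp0).symm⟩
  mul_mem' := by
    rintro _ _ ⟨m, hm, rfl⟩ ⟨n, hn, rfl⟩
    exact ⟨m + n, add_nonneg hm hn, (hM.peanoPow_add hp0 hm hn).symm⟩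

instance isValuationSubmonoid_powers [hp : Fact (Prime p)] :
    IsValuationSubmonoid (hM.powers hp0) where
  zero_notMem := by
    rintro ⟨n, hn, h⟩
    exact (hM.peanoPow_pos (hM.one_lt_of_prime hp.out hp0) hn).ne h
  exists_not_isUnit := ⟨p, ⟨1, zero_le_one, (hM.peanoPow_one hp0).symm⟩, hp.out.not_isUnit⟩
  total := by
    have of_le {m n : M} (hm : 0 ≤ m) (h : m ≤ n) :
        ∃ r ∈ hM.powers hp0, peanoPow p n = peanoPow p m * r :=
      ⟨peanoPow p (n - m), ⟨_, sub_nonneg.2 h, rfl⟩, by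
        rw [← hM.peanoPow_add hp0 hm (sub_nonneg.2 h), add_sub_cancel]⟩
    rintro _ ⟨m, hm, rfl⟩ _ ⟨n, hn, rfl⟩
    exact (le_total m n).imp (of_le hm) (of_le hn)
  exists_eq_mul x hx := by
    obtain ⟨n, u, hn, rfl, hu⟩ := hM.exists_eq_peanoPow_mul (hM.one_lt_of_prime hp.out hp0) hx
    refine ⟨_, ⟨n, hn, rfl⟩, u, rfl, ?_⟩
    rintro _ ⟨m, hm, rfl⟩
    exact hM.isCoprime_peanoPow hp0 ((hM.isCoprime_prime_iff hp.out hp0).2 hu) hm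

/-- The inverse limit of the rings `M ⧸ (p ^ n)` for `n ≥ 0` in `M`, a nonstandard analogue of the
ring of `p`-adic integers. -/
abbrev AdicCompletion : Subring (∀ s : hM.powers hp0, M ⧸ Ideal.span {(s : M)}) :=
  SubmonoidCompletion (hM.powers hp0)

instance henselianLocalRing_adicCompletion [hp : Fact (Prime p)] :
    HenselianLocalRing (hM.AdicCompletion hp0) := by
  have := SubmonoidCompletion.henselianRing (S := hM.powers hp0) <| by
    rintro ⟨_, n, hn, rfl⟩
    exact hM.henselianRing_quotient_peanoPow hp0 hp.out hn
  exact henselianLocalRing_of_henselianRing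

section ValueGroup

open SubmonoidCompletion

variable [hp : Fact (Prime p)]

include hM hp0 in
theorem isLocalRing_quotient_peanoPow {n : M} (hn : 0 < n) :
    IsLocalRing (M ⧸ Ideal.span {peanoPow p n}) := by
  have hp1 := hM.one_lt_of_prime hp.out hp0
  have : Nontrivial (M ⧸ Ideal.span {peanoPow p n}) := by
    rw [Ideal.Quotient.nontrivial_iff, Ne, Ideal.span_singleton_eq_top, isUnit_iff_dvd_one,
      ← hM.peanoPow_zero hp0, hM.peanoPow_dvd_peanoPow_iff hp1 hn.le le_rfl]
    exact hn.not_ge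
  exact .of_surjective' _ (eval_surjective (⟨peanoPow p n, n, hn.le, rfl⟩ : hM.powers hp0))

theorem of_peanoPow_ne_zero {n : M} (hn : 0 ≤ n) : of (hM.powers hp0) (peanoPow p n) ≠ 0 :=
  (map_ne_zero_iff _ of_injective).2 (hM.peanoPow_pos (hM.one_lt_of_prime hp.out hp0) hn).ne'

theorem exists_orderAddMonoidIso :
    ∃ e : M ≃+o AddValueGroup (hM.AdicCompletion hp0), ∀ (n : M) (hn : 0 ≤ n),
      e n = addVal (of (hM.powers hp0) (peanoPow p n)) (hM.of_peanoPow_ne_zero hp0 hn) := by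
  have hdvd (m n : {x : M // 0 ≤ x}) :
      of (hM.powers hp0) (peanoPow p m) ∣ of (hM.powers hp0) (peanoPow p n) ↔ m ≤ n := by
    rw [of_dvd_of_iff
        (IsValuationSubmonoid.mem_nonZeroDivisors (⟨_, m, m.2, rfl⟩ : hM.powers hp0)),
      hM.peanoPow_dvd_peanoPow_iff (hM.one_lt_of_prime hp.out hp0) m.2 n.2, Subtype.coe_le_coe]
  have hassoc (x : hM.AdicCompletion hp0) (hx : x ≠ 0) :
      ∃ n : {x : M // 0 ≤ x}, Associated (of (hM.powers hp0) (peanoPow p n)) x := by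
    obtain ⟨⟨_, n, hn, rfl⟩, u, hu, rfl⟩ := exists_eq_of_mul hx
    exact ⟨⟨n, hn⟩, associated_mul_unit_right _ u hu⟩
  obtain ⟨e, he⟩ := exists_orderAddMonoidIso_addValueGroup
    (fun n => hM.of_peanoPow_ne_zero hp0 n.2)
    (fun m n => by rw [← map_mul, Nonneg.coe_add, hM.peanoPow_add hp0 m.2 n.2]) hdvd hassoc
  exact ⟨e, fun n hn => he ⟨n, hn⟩⟩

theorem isUnramifiedValuation_adicCompletion :
    IsUnramifiedValuation (hM.AdicCompletion hp0) := by
  intro ℓ hℓ hmem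
  have hdvd : p ∣ (ℓ : M) := by
    by_contra h
    rw [IsLocalRing.mem_maximalIdeal, ← map_natCast (of _)] at hmem
    refine hmem (isUnit_iff_forall_eval.2 ?_)
    rintro ⟨_, n, hn, rfl⟩
    rw [eval_of, isUnit_mk_span_singleton_iff]
    exact hM.isCoprime_peanoPow hp0 ((hM.isCoprime_prime_iff hp.out hp0).2 h) hn
  obtain ⟨e, he⟩ := hM.exists_orderAddMonoidIso hp0
  have hof : of (hM.powers hp0) (peanoPow p 1) = ℓ := by
    rw [hM.peanoPow_one hp0]
    exact (congrArg _ (hM.natCast_prime_eq hp0 hp.out hℓ hdvd).symm).trans (map_natCast _ ℓ)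
  have hone := he 1 zero_le_one
  simp only [hof] at hone
  refine ⟨Nat.cast_ne_zero.2 hℓ.ne_zero, ?_⟩
  rw [← hone]
  exact isLeast_pos_map e hM.isLeast_pos_one

end ValueGroup

end IsPeanoRing

end PrimePowers

theorem mainTheorem9 {M : Type u} [CommRing M] [LinearOrder M] [IsStrictOrderedRing M]
    (hM : IsPeanoRing M) (p : M) (hp0 : 0 < p) (hp : Prime p) (k : M) (hk : 0 < k) :
    (∃ q : M, IsPow p k q) ∧
    ∀ q : M, IsPow p k q →
      ∃ (_ : IsLocalRing (M ⧸ Ideal.span {q}))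
        (R : Type u) (_ : CommRing R) (_ : IsDomain R) (_ : ValuationRing R),
        HenselianLocalRing R ∧ CharZero R ∧ IsUnramifiedValuation R ∧
        IsPresburgerGroup (AddValueGroup R) ∧
        ∃ (α : R) (hα : α ≠ 0),
          SegmentIso k (addVal α hα) ∧
          ∃ (e : (R ⧸ Ideal.span {α}) ≃+* (M ⧸ Ideal.span {q}))
            (g : IsLocalRing.ResidueField R ≃+*
              IsLocalRing.ResidueField (M ⧸ Ideal.span {q})),
            ∀ x : R, g (IsLocalRing.residue R x) =
              IsLocalRing.residue (M ⧸ Ideal.span {q}) (e (Ideal.Quotient.mk (Ideal.span {α}) x))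
      := by
  have hpow (q : M) := hM.isPow_iff_eq_peanoPow (q := q) hp0.le hk.le
  refine ⟨⟨_, (hpow _).2 rfl⟩, fun q hq => ?_⟩
  obtain rfl := (hpow q).1 hq
  have : Fact (Prime p) := ⟨hp⟩
  let s : hM.powers hp0.le := ⟨peanoPow p k, k, hk.le, rfl⟩
  have hlocal := hM.isLocalRing_quotient_peanoPow hp0.le hk
  have hker := SubmonoidCompletion.ker_eval (IsValuationSubmonoid.mem_nonZeroDivisors s)
  obtain ⟨e, he⟩ := hM.exists_orderAddMonoidIso hp0.le
  refine ⟨hlocal, hM.AdicCompletion hp0.le, inferInstance, inferInstance, inferInstance,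
    inferInstance, inferInstance, hM.isUnramifiedValuation_adicCompletion hp0.le,
    isPresburgerGroup_of_orderAddMonoidIso e hM.isPresburgerGroup,
    SubmonoidCompletion.of _ (peanoPow p k), hM.of_peanoPow_ne_zero hp0.le hk.le, ?_,
    exists_residueField_ringEquiv (SubmonoidCompletion.eval_surjective s) hker⟩
  rw [← he k hk.le]
  exact segmentIso_of_orderAddMonoidIso e k
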